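/- Let $(\mathcal A,h,D)$ be an essentially discrete spectral triple: $\mathcal A\subseteq B(h)$ is a $*$-algebra of bounded operators on a complex Hilbert space $h$, and $D$ is a densely defined self-adjoint operator on $h$ which has discrete spectrum away from its kernel, i.e. has a compact inverse on $\ker(D)^\perp$, such that for every $a\in\mathcal A$ the commutator $[D,a]$ is bounded (i.e. $a$ preserves the domain of $D$ and $Da-aD$ extends to a bounded operator on $h$). Let $P_0$ be the orthogonal projection onto $\ker D$, let $D^{-1}$ and $|D|^{-1}$ denote the inverses on $\ker(D)^\perp$, extended by $0$ on $\ker D$, and put ${\bf ds}=D^{-1}$, $$F_0=P_0+D|D|^{-1},\qquad F=P_0+\frac{D}{\sqrt{1+D^2}} .$$ Let $\lambda_1(|D|)\le\lambda_2(|D|)\le\cdots$ be the nonzero eigenvalues of $|D|$, repeated according to multiplicity (with $\lambda_n(|D|)=\infty$ if there are fewer than $n$ of them), and for a bounded operator $T$ and $k\ge 0$ let $\mu_k(T)=\inf\{\|T|_{E^\perp}\| : \dim E\le k\}$ be its singular values. Let $a\in\mathcal A$ be such that the commutator $[|D|,a]$ is also bounded. Then: 1. There are $\alpha_0,\beta_0\in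 B(h)$ with $$i[F_0,a]=\alpha_0|D|^{-1}+|D|^{-1}\beta_0,\qquad \|\alpha_0\|\le 2\|[D,a]\|,\quad \|\beta_0\|\le\|[D,a]\|+\|[|D|,a]\|,\quad \alpha_0=P_0\alpha_0 .$$ There is also such a representation in which, instead, $\|\alpha_0\|\le\|[D,a]\|+\|[|D|,a]\|$, $\|\beta_0\|\le 2\|[D,a]\|$ and $\beta_0=\beta_0P_0$. 2. There are $\alpha_1,\beta_1\in B(h)$ with $i[F,a]=\alpha_1|D|^{-1}+|D|^{-1}\beta_1$, $\|\alpha_1\|\le 2\|[D,a]\|$, $\alpha_1=P_0\alpha_1$, and both $$\|\beta_1\|\le 3\|[D,a]\|+\sqrt{1+\lambda_1(|D|)^{-2}}\,\|[|D|,a]\|\ \text{ (if } D\ne0),\qquad \|\beta_1\|\le 3\|[D,a]\|+\|[|D|,a]\|+2\|a\| .$$ There is also such a representation in which the bounds for $\alpha_1$ and $\beta_1$ are interchanged and $\beta_1=\beta_1P_0$. 3. Both quantum differentials $da=i[F_0,a]$ and $da=i[F,a]$ lie in the two-sided ideal of $B(h)$ generated by ${\bf ds}=D^{-1}$, and in the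 one generated by $|D|^{-1}$. 4. $\mu_k(|D|^{-1})=\lambda_{k+1}(|D|)^{-1}$ for all $k\ge0$. For $da=i[F_0,a]$ or $da=i[F,a]$ and for any $\alpha,\beta\in B(h)$ with $da=\alpha|D|^{-1}+|D|^{-1}\beta$, $$\mu_{2k}(da)\le(\|\alpha\|+\|\beta\|)\,\mu_k(|D|^{-1})\qquad(k\ge0).$$ In particular, there is a constant $C$, independent of $k$, with $\mu_{2k}(da)\le C\,\mu_k({\bf ds})$ for all $k\ge0$. -/

import Mathlib

open scoped ENNReal InnerProductSpace

noncomputable section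

namespace QuantumDifferential

variable {H : Type*} [NormedAddCommGroup H] [InnerProductSpace ℂ H]

/-- The eigenspace `ker (T - t)` of an unbounded operator `T`, for a real number `t`. -/
def eigenspace (T : H →ₗ.[ℂ] H) (t : ℝ) : Submodule ℂ H where
  carrier := {x | (x, (t : ℂ) • x) ∈ T.graph}
  zero_mem' := by
    have := T.graph.zero_mem
    rwa [Set.mem_ofPred_eq, smul_zero]
  add_mem' := by
    intro x y hx hy
    have := T.graph.add_mem hx hy
    simpa [smul_add] using this
  smul_mem' := by
    intro c x hx
    have := T.graph.smul_mem c hx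
    simpa [smul_comm c] using this

/-- The bounded operator `C` is the commutator `[T, a]` of an unbounded operator `T` and a bounded
operator `a`: `a` preserves the domain of `T`, and `T a x - a T x = C x` on it. -/
def IsCommutator (T : H →ₗ.[ℂ] H) (a C : H →L[ℂ] H) : Prop :=
  ∀ x : T.domain, ∃ hx : a x ∈ T.domain, T ⟨a x, hx⟩ - a (T x) = C x

/-- The commutator `[T, a]` is bounded. -/
def HasBoundedCommutator (T : H →ₗ.[ℂ] H) (a : H →L[ℂ] H) : Prop :=
  ∃ C : H →L[ℂ] H, IsCommutator T a C

open scoped Classical in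
/-- The bounded operator `[T, a]`, when the commutator is bounded (it is unique for a densely
defined `T`); the value is `0` otherwise. -/
def commutator (T : H →ₗ.[ℂ] H) (a : H →L[ℂ] H) : H →L[ℂ] H :=
  if h : HasBoundedCommutator T a then h.choose else 0

/-- The singular value `μ_k(T)`, `k ≥ 0`: the infimum of the norms `‖T|_{E^⊥}‖ = ‖T (1 - P_E)‖` over
the subspaces `E` of dimension at most `k`. In particular `μ_0(T) = ‖T‖`. -/
def singularValue (k : ℕ) (T : H →L[ℂ] H) : ℝ :=
  ⨅ E : {E : Submodule ℂ H // FiniteDimensional ℂ E ∧ Module.finrank ℂ E ≤ k},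
    ‖T ∘L (E.1)ᗮ.subtypeL‖

/-- `λ_n(T)`, `n ≥ 1`: the `n`-th positive eigenvalue of `T`, in increasing order and counted with
multiplicity; it is `∞` if `T` has fewer than `n` positive eigenvalues. It is the least `s > 0` such
that the eigenvalues in `(0, s]` have total multiplicity at least `n`. -/
def eigenvalueSeq (T : H →ₗ.[ℂ] H) (n : ℕ) : ℝ≥0∞ :=
  sInf {r | ∃ s : ℝ, 0 < s ∧ r = ENNReal.ofReal s ∧
    (n : Cardinal) ≤ Module.rank ℂ (⨆ t ∈ Set.Ioc (0 : ℝ) s, eigenspace T t : Submodule ℂ H)}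

variable [CompleteSpace H]

/-- The orthogonal projection onto the eigenspace `ker (D - t)`. (The eigenspaces of a self-adjoint
operator are closed, so that the closure changes nothing.) -/
def eigenProj (D : H →ₗ.[ℂ] H) (t : ℝ) : H →L[ℂ] H :=
  (eigenspace D t).topologicalClosure.starProjection

/-- The functional calculus `f(D) x = ∑ f(t) P_t x` of a self-adjoint operator `D` with pure point
spectrum, where `P_t` is the orthogonal projection onto `ker (D - t)`. Since the `P_t x` are pairwise
orthogonal, the domain consists of the `x` with `∑ |f(t)|² ‖P_t x‖² < ∞`. -/
def fnCalc (D : H →ₗ.[ℂ] H) (f : ℝ → ℝ) : H →ₗ.[ℂ] H where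
  domain :=
    { carrier := {x | Summable fun t : ℝ => (f t : ℂ) • eigenProj D t x}
      zero_mem' := by simp
      add_mem' := by
        intro x y hx hy
        simpa [smul_add] using Summable.add hx hy
      smul_mem' := by
        intro c x hx
        have := Summable.const_smul c hx
        simpa [smul_comm c] using this }
  toFun :=
    { toFun := fun x => ∑' t : ℝ, (f t : ℂ) • eigenProj D t x
      map_add' := by
        rintro ⟨x, hx⟩ ⟨y, hy⟩
        simpa [smul_add] using Summable.tsum_add hx hy
      map_smul' := by
        rintro c ⟨x, hx⟩
        have := Summable.tsum_const_smul c hx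
        simpa [smul_comm c] using this }

open scoped Classical in
/-- `f(D)` as a bounded operator, when it is bounded and everywhere defined
(see `bddFnCalc_toPMap`); the value is `0` otherwise. -/
def bddFnCalc (D : H →ₗ.[ℂ] H) (f : ℝ → ℝ) : H →L[ℂ] H :=
  if h : ∃ B : H →L[ℂ] H, (B : H →ₗ[ℂ] H).toPMap ⊤ = fnCalc D f then h.choose else 0

/-- The orthogonal projection `P₀` onto `ker D`. -/
def kerProj (D : H →ₗ.[ℂ] H) : H →L[ℂ] H := eigenProj D 0

/-- The absolute value `|D|`. -/
def absOp (D : H →ₗ.[ℂ] H) : H →ₗ.[ℂ] H := fnCalc D fun t => |t|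

/-- The operator `|D|⁻¹`, vanishing on `ker D`. -/
def absInv (D : H →ₗ.[ℂ] H) : H →L[ℂ] H := bddFnCalc D fun t => |t|⁻¹

/-- The line element `ds = D⁻¹`, vanishing on `ker D`. -/
def lineElement (D : H →ₗ.[ℂ] H) : H →L[ℂ] H := bddFnCalc D fun t => t⁻¹

/-- The symmetry `F₀ = P₀ + D |D|⁻¹`. -/
def phase₀ (D : H →ₗ.[ℂ] H) : H →L[ℂ] H :=
  kerProj D + bddFnCalc D fun t => t * |t|⁻¹

/-- The Fredholm operator `F = P₀ + D (1 + D²)^(-1/2)`. -/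
def phase (D : H →ₗ.[ℂ] H) : H →L[ℂ] H :=
  kerProj D + bddFnCalc D fun t => t / √(1 + t ^ 2)

/-- The quantum differential `da = i[F, a]`. -/
def qdiff (F a : H →L[ℂ] H) : H →L[ℂ] H := Complex.I • (F * a - a * F)

/-- A self-adjoint operator is essentially discrete if it has discrete spectrum away from its
kernel, i.e. if it has a compact inverse on the orthogonal complement of its kernel: there is a
compact operator `K` (namely `D⁻¹`) vanishing on `ker D` with `K D = D K = 1 - P₀`. -/
def IsEssentiallyDiscrete (D : H →ₗ.[ℂ] H) : Prop :=
  ∃ K : H →L[ℂ] H, IsCompactOperator K ∧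
    (∀ x ∈ eigenspace D 0, K x = 0) ∧
    (∀ x : D.domain, K (D x) = x - kerProj D x) ∧
    (∀ y : H, ∃ hy : K y ∈ D.domain, D ⟨K y, hy⟩ = y - kerProj D y)

/-- `(A, H, D)` is an essentially discrete spectral triple: `A` is a `*`-algebra of bounded operators
on the Hilbert space `H`, and `D` is a (densely defined) self-adjoint, essentially discrete operator
such that `[D, a]` is bounded for every `a ∈ A`. -/
structure IsEssDiscreteSpectralTriple (A : NonUnitalStarSubalgebra ℂ (H →L[ℂ] H))
    (D : H →ₗ.[ℂ] H) : Prop where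
  isSelfAdjoint : IsSelfAdjoint D
  isEssentiallyDiscrete : IsEssentiallyDiscrete D
  hasBoundedCommutator : ∀ a ∈ A, HasBoundedCommutator D a

lemma isClosed_eigenspace {D : H →ₗ.[ℂ] H} (hD : IsSelfAdjoint D) (t : ℝ) :
    IsClosed (eigenspace D t : Set H) := by
  have h : IsClosed (D.graph : Set (H × H)) := hD.isClosed
  exact h.preimage (f := fun x : H => (x, (t : ℂ) • x)) (by fun_prop)

lemma inner_eigenspace {D : H →ₗ.[ℂ] H} (hD : IsSelfAdjoint D) {s t : ℝ} (hst : s ≠ t) {x y : H}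
    (hx : x ∈ eigenspace D s) (hy : y ∈ eigenspace D t) : ⟪x, y⟫_ℂ = 0 := by
  have hx' : (x, (s : ℂ) • x) ∈ D.graph := hx
  have hy' : (y, (t : ℂ) • y) ∈ D.graph := hy
  rw [LinearPMap.mem_graph_iff] at hx' hy'
  obtain ⟨x', hx1, hx2⟩ := hx'
  obtain ⟨y', hy1, hy2⟩ := hy'
  have h0 := LinearPMap.adjoint_isFormalAdjoint hD.dense_domain
  rw [LinearPMap.isSelfAdjoint_def.mp hD] at h0
  have h := h0 x' y'
  simp only at hx1 hx2 hy1 hy2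
  rw [hx2, hy2, hx1, hy1, inner_smul_left, inner_smul_right, Complex.conj_ofReal] at h
  have h1 : ((s : ℂ) - t) * ⟪x, y⟫_ℂ = 0 := by rw [sub_mul, h, sub_self]
  refine (mul_eq_zero.mp h1).resolve_left ?_
  exact sub_ne_zero.mpr (by exact_mod_cast hst)

lemma eigenProj_mem {D : H →ₗ.[ℂ] H} (hD : IsSelfAdjoint D) (t : ℝ) (x : H) :
    eigenProj D t x ∈ eigenspace D t := by
  have h : eigenProj D t x ∈ (eigenspace D t).topologicalClosure :=
    Submodule.starProjection_apply_mem (eigenspace D t).topologicalClosure x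
  rwa [(isClosed_eigenspace hD t).submodule_topologicalClosure_eq] at h

lemma orthogonalFamily_eigenspace {D : H →ₗ.[ℂ] H} (hD : IsSelfAdjoint D) :
    OrthogonalFamily ℂ (fun t : ℝ => eigenspace D t) fun t => (eigenspace D t).subtypeₗᵢ :=
  fun _ _ hst x y => inner_eigenspace hD hst x.2 y.2

lemma inner_eigenProj (D : H →ₗ.[ℂ] H) (t : ℝ) (x : H) :
    ⟪x, eigenProj D t x⟫_ℂ = ((‖eigenProj D t x‖ ^ 2 : ℝ) : ℂ) := by
  set E := (eigenspace D t).topologicalClosure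
  have h : ⟪E.starProjection x, E.starProjection x⟫_ℂ = ⟪x, E.starProjection x⟫_ℂ := by
    rw [Submodule.inner_starProjection_left_eq_right,
      Submodule.starProjection_eq_self_iff.mpr (Submodule.starProjection_apply_mem E x)]
  change ⟪x, E.starProjection x⟫_ℂ = ((‖E.starProjection x‖ ^ 2 : ℝ) : ℂ)
  rw [← h, inner_self_eq_norm_sq_to_K]
  simp

lemma sum_norm_eigenProj_le {D : H →ₗ.[ℂ] H} (hD : IsSelfAdjoint D) (s : Finset ℝ) (x : H) :
    ∑ t ∈ s, ‖eigenProj D t x‖ ^ 2 ≤ ‖x‖ ^ 2 := by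
  set y := ∑ t ∈ s, eigenProj D t x with hy
  have h1 : ‖y‖ ^ 2 = ∑ t ∈ s, ‖eigenProj D t x‖ ^ 2 :=
    (orthogonalFamily_eigenspace hD).norm_sum (fun t => ⟨_, eigenProj_mem hD t x⟩) s
  have h2 : ⟪x, y⟫_ℂ = ((‖y‖ ^ 2 : ℝ) : ℂ) := by
    rw [h1, hy, inner_sum, Complex.ofReal_sum]
    exact Finset.sum_congr rfl fun t _ => inner_eigenProj D t x
  have h3 : ‖y‖ ^ 2 ≤ ‖x‖ * ‖y‖ := by
    have := norm_inner_le_norm (𝕜 := ℂ) x y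
    rwa [h2, Complex.norm_real, Real.norm_of_nonneg (by positivity)] at this
  rw [← h1]
  nlinarith [norm_nonneg x, norm_nonneg y, sq_nonneg (‖x‖ - ‖y‖)]

lemma summable_fnCalc {D : H →ₗ.[ℂ] H} (hD : IsSelfAdjoint D) {f : ℝ → ℝ} {C : ℝ}
    (hC : ∀ t, eigenspace D t ≠ ⊥ → |f t| ≤ C) (x : H) :
    (Summable fun t : ℝ => (f t : ℂ) • eigenProj D t x) ∧
      ‖∑' t : ℝ, (f t : ℂ) • eigenProj D t x‖ ≤ |C| * ‖x‖ := by
  have hterm : ∀ t, ‖(f t : ℂ) • eigenProj D t x‖ ^ 2 ≤ C ^ 2 * ‖eigenProj D t x‖ ^ 2 := by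
    intro t
    by_cases h : eigenspace D t = ⊥
    · have h0 := eigenProj_mem hD t x
      rw [h, Submodule.mem_bot] at h0
      simp [h0]
    · rw [norm_smul, mul_pow, Complex.norm_real, Real.norm_eq_abs]
      have := hC t h
      gcongr
  have hfin : ∀ s : Finset ℝ, ∑ t ∈ s, ‖(f t : ℂ) • eigenProj D t x‖ ^ 2 ≤ C ^ 2 * ‖x‖ ^ 2 := by
    intro s
    refine (Finset.sum_le_sum fun t _ => hterm t).trans ?_
    rw [← Finset.mul_sum]
    exact mul_le_mul_of_nonneg_left (sum_norm_eigenProj_le hD s x) (sq_nonneg C)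
  let v : ∀ t : ℝ, eigenspace D t := fun t =>
    ⟨(f t : ℂ) • eigenProj D t x, (eigenspace D t).smul_mem _ (eigenProj_mem hD t x)⟩
  have hs : Summable fun t : ℝ => (f t : ℂ) • eigenProj D t x :=
    ((orthogonalFamily_eigenspace hD).summable_iff_norm_sq_summable v).mpr
      (summable_of_sum_le (fun t => by positivity) hfin)
  refine ⟨hs, le_of_tendsto hs.hasSum.norm (Filter.Eventually.of_forall fun s => ?_)⟩
  have h1 : ‖∑ t ∈ s, (f t : ℂ) • eigenProj D t x‖ ^ 2
      = ∑ t ∈ s, ‖(f t : ℂ) • eigenProj D t x‖ ^ 2 :=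
    (orthogonalFamily_eigenspace hD).norm_sum v s
  refine le_of_sq_le_sq ?_ (by positivity)
  rw [h1, mul_pow, sq_abs]
  exact hfin s

/-- If `D` is self-adjoint and `f` is bounded on the eigenvalues of `D`, then `bddFnCalc D f` is the
operator `f(D)`, which is defined everywhere. -/
theorem bddFnCalc_toPMap {D : H →ₗ.[ℂ] H} (hD : IsSelfAdjoint D) {f : ℝ → ℝ} {C : ℝ}
    (hC : ∀ t, eigenspace D t ≠ ⊥ → |f t| ≤ C) :
    (bddFnCalc D f : H →ₗ[ℂ] H).toPMap ⊤ = fnCalc D f := by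
  have hdom : ∀ x : H, x ∈ (fnCalc D f).domain := fun x => (summable_fnCalc hD hC x).1
  let B₀ : H →ₗ[ℂ] H := (fnCalc D f).toFun ∘ₗ LinearMap.codRestrict _ LinearMap.id hdom
  have hB : ∃ B : H →L[ℂ] H, (B : H →ₗ[ℂ] H).toPMap ⊤ = fnCalc D f := by
    refine ⟨B₀.mkContinuous |C| fun x => (summable_fnCalc hD hC x).2, ?_⟩
    refine LinearPMap.ext ?_ ?_
    · ext x
      simpa using hdom x
    · intro x hx hx'
      rfl
  unfold bddFnCalc
  rw [dif_pos hB]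
  exact hB.choose_spec

end QuantumDifferential

end

open scoped ENNReal InnerProductSpace

noncomputable section

namespace QuantumDifferential

variable {H : Type*} [NormedAddCommGroup H] [InnerProductSpace ℂ H]
  {D : H →ₗ.[ℂ] H} {a : H →L[ℂ] H}

/-! ### Operators acting diagonally on the eigenspaces, and kernels relative to them -/

/-! The eigenvectors of `D` are total, so a bounded operator is determined by its matrix entries
between them (`ext_eigenspace`). The commutator of `a` with `f(D)` multiplies the entry of `a`
between eigenvalues `s` and `t` by `f s - f t`. Every operator identity below is thereby a scalar
identity in `s` and `t`, and each norm bound comes from writing an operator algebraically through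
others already known to be bounded.

Let `F = φ(D)` with `φ 0 = 1`, and write `d`, `b`, `c` for the commutators of `a` with `D`, `|D|`,
`|D| F`. Off the kernel on the left, `[F, a] = |D|⁻¹ (c - b F)`. On the kernel, `1 - φ t = t G(t)
|t|⁻¹` with `G` the sign of `t` times `1 - φ t`, which gives the term `-P₀ d G |D|⁻¹` with `|G| ≤
2`. This is `commutator_eq_left`; `commutator_eq_right` is its mirror image.

For `F₀` one has `|D| F₀ = D`, hence `c = d`. For `F`, the function `t - |t| φ t` is bounded by `1`,
which gives the estimate with `2‖a‖`. The estimate with the least eigenvalue `l` needs a bound for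
the compressed commutator with `√(1 + D²)` (`exists_norm_sqrt_commutator_le`). There `X = √(1 + D²)
- |D|` satisfies `X⁻¹ - X = 2|D|` off the kernel, so that `e = [X, a]`, compressed to that
complement, satisfies `e = -X e X - 2 X b X`; as `‖X‖ < 1`, this bounds `e` by `b`.

The ideal membership is immediate from `|D|⁻¹ = sgn(D) D⁻¹`. The singular value inequality comes
from enlarging a test space `E` to `E + β* E`, and the values `μ_k(|D|⁻¹)` from a dimension count
against the spectral subspaces of `|D|`. -/

lemma mem_eigenspace_iff {T : H →ₗ.[ℂ] H} {t : ℝ} {x : H} :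
    x ∈ eigenspace T t ↔ ∃ hx : x ∈ T.domain, T ⟨x, hx⟩ = (t : ℂ) • x := by
  change (x, (t : ℂ) • x) ∈ T.graph ↔ _
  rw [LinearPMap.mem_graph_iff]
  constructor
  · rintro ⟨y, rfl, h⟩
    exact ⟨y.2, h⟩
  · rintro ⟨hx, h⟩
    exact ⟨⟨x, hx⟩, rfl, h⟩

lemma isCommutator_commutator {T : H →ₗ.[ℂ] H} (h : HasBoundedCommutator T a) :
    IsCommutator T a (commutator T a) := by
  unfold commutator
  rw [dif_pos h]
  exact h.choose_spec

/-- The operator `T` acts on the eigenspaces of `D`, on both sides, like `f(D)`. -/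
structure IsFn (D : H →ₗ.[ℂ] H) (T : H →L[ℂ] H) (f : ℝ → ℝ) : Prop where
  apply : ∀ ⦃t x⦄, x ∈ eigenspace D t → T x = (f t : ℂ) • x
  inner : ∀ ⦃s y⦄, y ∈ eigenspace D s → ∀ z, ⟪y, T z⟫_ℂ = f s * ⟪y, z⟫_ℂ

lemma isFn_one : IsFn D (1 : H →L[ℂ] H) 1 where
  apply t x _ := by simp
  inner s y _ z := by simp

lemma IsFn.add {T T' : H →L[ℂ] H} {f f' : ℝ → ℝ} (h : IsFn D T f) (h' : IsFn D T' f') :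
    IsFn D (T + T') (fun t => f t + f' t) where
  apply t x hx := by simp [h.apply hx, h'.apply hx, add_smul]
  inner s y hy z := by simp [h.inner hy, h'.inner hy, add_mul]

lemma IsFn.sub {T T' : H →L[ℂ] H} {f f' : ℝ → ℝ} (h : IsFn D T f) (h' : IsFn D T' f') :
    IsFn D (T - T') (fun t => f t - f' t) where
  apply t x hx := by simp [h.apply hx, h'.apply hx, sub_smul]
  inner s y hy z := by simp [h.inner hy, h'.inner hy, sub_mul]

lemma IsFn.mul {T T' : H →L[ℂ] H} {f f' : ℝ → ℝ} (h : IsFn D T f) (h' : IsFn D T' f') :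
    IsFn D (T * T') (fun t => f t * f' t) where
  apply t x hx := by rw [mul_apply_eq_comp, h'.apply hx, map_smul, h.apply hx, smul_smul, mul_comm,
      Complex.ofReal_mul]
  inner s y hy z := by simp [h.inner hy, h'.inner hy, mul_assoc]

/-- Between eigenvectors of `D` with eigenvalues `s` and `t`, the matrix entries of `T` are `k s t`
times those of `a`. -/
def HasKernel (D : H →ₗ.[ℂ] H) (a T : H →L[ℂ] H) (k : ℝ → ℝ → ℝ) : Prop :=
  ∀ ⦃s t y x⦄, y ∈ eigenspace D s → x ∈ eigenspace D t → ⟪y, T x⟫_ℂ = k s t * ⟪y, a x⟫_ℂ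

lemma HasKernel.add {T T' : H →L[ℂ] H} {k k' : ℝ → ℝ → ℝ} (h : HasKernel D a T k)
    (h' : HasKernel D a T' k') : HasKernel D a (T + T') fun s t => k s t + k' s t :=
  fun s t y x hy hx => by simp [h hy hx, h' hy hx, add_mul]

lemma HasKernel.sub {T T' : H →L[ℂ] H} {k k' : ℝ → ℝ → ℝ} (h : HasKernel D a T k)
    (h' : HasKernel D a T' k') : HasKernel D a (T - T') fun s t => k s t - k' s t :=
  fun s t y x hy hx => by simp [h hy hx, h' hy hx, sub_mul]

lemma HasKernel.neg {T : H →L[ℂ] H} {k : ℝ → ℝ → ℝ} (h : HasKernel D a T k) :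
    HasKernel D a (-T) fun s t => -k s t :=
  fun s t y x hy hx => by simp [h hy hx]

lemma IsFn.mul_kernel {S T : H →L[ℂ] H} {f : ℝ → ℝ} {k : ℝ → ℝ → ℝ} (hS : IsFn D S f)
    (h : HasKernel D a T k) : HasKernel D a (S * T) fun s t => f s * k s t :=
  fun s t y x hy hx => by simp [hS.inner hy, h hy hx, mul_assoc]

lemma HasKernel.mul_fn {S T : H →L[ℂ] H} {f : ℝ → ℝ} {k : ℝ → ℝ → ℝ} (h : HasKernel D a T k)
    (hS : IsFn D S f) : HasKernel D a (T * S) fun s t => k s t * f t :=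
  fun s t y x hy hx => by
    simp [hS.apply hx, h hy hx, mul_assoc, mul_left_comm]

lemma IsFn.commutator_kernel {S : H →L[ℂ] H} {f : ℝ → ℝ} (hS : IsFn D S f) :
    HasKernel D a (S * a - a * S) fun s t => f s - f t :=
  fun s t y x hy hx => by
    simp [hS.apply hx, hS.inner hy, sub_mul]

variable [CompleteSpace H]

/-! ### Completeness of the eigenspaces -/

lemma inner_map_of_isSelfAdjoint (hD : IsSelfAdjoint D) (x y : D.domain) :
    ⟪D x, (y : H)⟫_ℂ = ⟪(x : H), D y⟫_ℂ := by
  have h := LinearPMap.adjoint_isFormalAdjoint hD.dense_domain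
  rw [LinearPMap.isSelfAdjoint_def.mp hD] at h
  exact h x y

lemma inner_map_of_mem_eigenspace (hD : IsSelfAdjoint D) {s : ℝ} {y : H} (hy : y ∈ eigenspace D s)
    (x : D.domain) : ⟪y, D x⟫_ℂ = s * ⟪y, (x : H)⟫_ℂ := by
  obtain ⟨hy', h⟩ := mem_eigenspace_iff.mp hy
  have := inner_map_of_isSelfAdjoint hD ⟨y, hy'⟩ x
  rw [← this, h, inner_smul_left, Complex.conj_ofReal]

lemma eigenProj_of_mem (hD : IsSelfAdjoint D) {t : ℝ} {x : H} (hx : x ∈ eigenspace D t) :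
    eigenProj D t x = x := by
  refine Submodule.starProjection_eq_self_iff.mpr ?_
  rwa [(isClosed_eigenspace hD t).submodule_topologicalClosure_eq]

lemma inner_eigenProj_of_mem (hD : IsSelfAdjoint D) {t : ℝ} {x : H} (hx : x ∈ eigenspace D t)
    (z : H) : ⟪x, eigenProj D t z⟫_ℂ = ⟪x, z⟫_ℂ := by
  unfold eigenProj
  rw [← Submodule.inner_starProjection_left_eq_right]
  exact congrArg (⟪·, z⟫_ℂ) (eigenProj_of_mem hD hx)

lemma inner_eigenProj_of_ne (hD : IsSelfAdjoint D) {s t : ℝ} (hst : s ≠ t) {x : H}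
    (hx : x ∈ eigenspace D s) (z : H) : ⟪x, eigenProj D t z⟫_ℂ = 0 :=
  inner_eigenspace hD hst hx (eigenProj_mem hD t z)

lemma eigenProj_of_mem_of_ne (hD : IsSelfAdjoint D) {s t : ℝ} (hst : s ≠ t) {x : H}
    (hx : x ∈ eigenspace D s) : eigenProj D t x = 0 := by
  have h := inner_eigenProj_of_mem hD (eigenProj_mem hD t x) x
  rw [inner_eigenspace hD hst.symm (eigenProj_mem hD t x) hx] at h
  exact inner_self_eq_zero.mp h

/-- The eigenvectors of an essentially discrete self-adjoint operator are total. -/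
lemma eq_zero_of_inner_eigenspace (hD : IsSelfAdjoint D) (hE : IsEssentiallyDiscrete D) {x : H}
    (h : ∀ t, ∀ y ∈ eigenspace D t, ⟪y, x⟫_ℂ = 0) : x = 0 := by
  obtain ⟨K, hK, hK0, hKD, hDK⟩ := hE
  -- The range of `K` is orthogonal to `ker D`, so pairing `K x` with `y` is the same as pairing it
  -- with `D K y`; the symmetry of `D` then passes to `K`.
  have hKP : ∀ y, kerProj D (K y) = 0 := by
    intro y
    obtain ⟨hy, hy'⟩ := hDK y
    have := hKD ⟨K y, hy⟩
    rw [hy', map_sub, hK0 (kerProj D y) (eigenProj_mem hD 0 y), sub_zero] at this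
    exact sub_eq_self.mp this.symm
  have hKi : ∀ x y, ⟪K x, kerProj D y⟫_ℂ = 0 := by
    intro x y
    unfold kerProj eigenProj
    rw [← Submodule.inner_starProjection_left_eq_right]
    have := hKP x
    unfold kerProj eigenProj at this
    rw [this, inner_zero_left]
  have hsymm : (K : H →ₗ[ℂ] H).IsSymmetric := by
    intro x y
    obtain ⟨hx, hx'⟩ := hDK x
    obtain ⟨hy, hy'⟩ := hDK y
    have h1 : ⟪K x, y⟫_ℂ = ⟪K x, D ⟨K y, hy⟩⟫_ℂ := by
      rw [hy', inner_sub_right, hKi, sub_zero]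
    have h2 : ⟪x, K y⟫_ℂ = ⟪D ⟨K x, hx⟩, K y⟫_ℂ := by
      rw [hx', inner_sub_left, ← inner_conj_symm (kerProj D x), hKi, map_zero, sub_zero]
    have h3 := inner_map_of_isSelfAdjoint hD ⟨K x, hx⟩ ⟨K y, hy⟩
    change ⟪K x, y⟫_ℂ = ⟪x, K y⟫_ℂ
    rw [h1, h2, h3]
  -- Compactness enters here: the eigenvectors of `K` are total, and it remains to see that each of
  -- them is an eigenvector of `D`.
  have hbot := ContinuousLinearMap.orthogonalComplement_iSup_eigenspaces_eq_bot hK hsymm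
  rw [← Submodule.mem_bot ℂ, ← hbot, Submodule.mem_orthogonal]
  intro u hu
  have hle : (⨆ μ, Module.End.eigenspace (K : H →ₗ[ℂ] H) μ) ≤ (Submodule.span ℂ {x})ᗮ := by
    refine iSup_le fun μ v hv => ?_
    rw [Submodule.mem_orthogonal_singleton_iff_inner_left]
    rcases eq_or_ne v 0 with rfl | hv0
    · exact inner_zero_left _
    have hev : Module.End.HasEigenvalue (K : H →ₗ[ℂ] H) μ :=
      Module.End.hasEigenvalue_of_hasEigenvector ⟨hv, hv0⟩
    have hμ := hsymm.conj_eigenvalue_eq_self hev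
    obtain ⟨r, rfl⟩ := Complex.conj_eq_iff_real.mp hμ
    rw [Module.End.mem_eigenspace_iff] at hv
    change K v = (r : ℂ) • v at hv
    obtain ⟨hy, hy'⟩ := hDK v
    -- For `r = 0`, `v - P₀ v = D K v = 0` puts `v` in `ker D`; for `r ≠ 0`, `v` is an eigenvector
    -- of `D` for `r⁻¹`.
    rcases eq_or_ne r 0 with rfl | hr
    · refine h 0 v ?_
      have h0 : K v = 0 := by simpa using hv
      have h1 : D ⟨K v, hy⟩ = 0 := by
        rw [show (⟨K v, hy⟩ : D.domain) = 0 from Subtype.ext h0, LinearPMap.map_zero]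
      rw [h1] at hy'
      rw [sub_eq_zero.mp hy'.symm]
      exact eigenProj_mem hD 0 v
    · refine h r⁻¹ v ?_
      have hr' : (r : ℂ) ≠ 0 := by exact_mod_cast hr
      have hvK : v = (r : ℂ)⁻¹ • K v := by rw [hv, inv_smul_smul₀ hr']
      have hP : kerProj D v = 0 := by rw [hvK, map_smul, hKP, smul_zero]
      rw [hP, sub_zero] at hy'
      have hmem : K v ∈ eigenspace D r⁻¹ := by
        refine mem_eigenspace_iff.mpr ⟨hy, ?_⟩
        rw [hy', Complex.ofReal_inv]
        exact hvK
      rw [hvK]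
      exact Submodule.smul_mem _ _ hmem
  exact Submodule.mem_orthogonal_singleton_iff_inner_left.mp (hle hu)

/-- The nonzero spectrum of an essentially discrete operator is bounded away from `0`. -/
lemma exists_abs_inv_le (hD : IsSelfAdjoint D) (hE : IsEssentiallyDiscrete D) :
    ∃ C : ℝ, 0 ≤ C ∧ ∀ t, eigenspace D t ≠ ⊥ → |t|⁻¹ ≤ C := by
  obtain ⟨K, -, hK0, hKD, -⟩ := hE
  refine ⟨‖K‖, norm_nonneg K, fun t ht => ?_⟩
  rcases eq_or_ne t 0 with rfl | ht0
  · simp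
  obtain ⟨x, hx, hx0⟩ := Submodule.exists_mem_ne_zero_of_ne_bot ht
  obtain ⟨hx', h⟩ := mem_eigenspace_iff.mp hx
  have h1 := hKD ⟨x, hx'⟩
  rw [h, kerProj, eigenProj_of_mem_of_ne hD ht0 hx, map_smul, sub_zero] at h1
  have h2 : ‖x‖ ≤ |t| * (‖K‖ * ‖x‖) := by
    calc ‖x‖ = |t| * ‖K x‖ := by
          conv_lhs => rw [← show (t : ℂ) • K x = x from h1]
          rw [norm_smul, Complex.norm_real, Real.norm_eq_abs]
      _ ≤ _ := by gcongr; exact K.le_opNorm x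
  have hxp : 0 < ‖x‖ := norm_pos_iff.mpr hx0
  have htp : 0 < |t| := abs_pos.mpr ht0
  rw [inv_le_iff_one_le_mul₀ htp]
  nlinarith

/-- Two operators with the same matrix entries between eigenvectors agree. -/
lemma ext_eigenspace (hD : IsSelfAdjoint D) (hE : IsEssentiallyDiscrete D) {T T' : H →L[ℂ] H}
    (h : ∀ s t, ∀ y ∈ eigenspace D s, ∀ x ∈ eigenspace D t, ⟪y, T x⟫_ℂ = ⟪y, T' x⟫_ℂ) :
    T = T' := by
  have h1 : ∀ t, ∀ x ∈ eigenspace D t, (T - T') x = 0 := fun t x hx =>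
    eq_zero_of_inner_eigenspace hD hE fun s y hy => by
      rw [sub_apply, inner_sub_right, h s t y hy x hx, sub_self]
  -- Vanishing on all eigenvectors passes to the whole space through the adjoint, whose values are
  -- orthogonal to every eigenvector.
  have h2 : ContinuousLinearMap.adjoint (T - T') = 0 := by
    ext y
    refine eq_zero_of_inner_eigenspace hD hE fun t x hx => ?_
    rw [ContinuousLinearMap.adjoint_inner_right, h1 t x hx, inner_zero_left]
  rw [map_eq_zero_iff _ (LinearIsometryEquiv.injective _)] at h2
  exact sub_eq_zero.mp h2

/-! ### Functional calculus on eigenvectors -/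

lemma inner_fnCalc (hD : IsSelfAdjoint D) {f : ℝ → ℝ} {s : ℝ} {y : H} (hy : y ∈ eigenspace D s)
    (z : (fnCalc D f).domain) : ⟪y, fnCalc D f z⟫_ℂ = f s * ⟪y, (z : H)⟫_ℂ := by
  have hz : Summable fun t : ℝ => (f t : ℂ) • eigenProj D t z := z.2
  change ⟪y, ∑' t : ℝ, (f t : ℂ) • eigenProj D t z⟫_ℂ = _
  have h1 : HasSum (fun t : ℝ => ⟪y, (f t : ℂ) • eigenProj D t z⟫_ℂ)
      ⟪y, ∑' t : ℝ, (f t : ℂ) • eigenProj D t z⟫_ℂ := hz.hasSum.mapL (innerSL ℂ y)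
  have h2 : HasSum (fun t : ℝ => ⟪y, (f t : ℂ) • eigenProj D t z⟫_ℂ)
      ⟪y, (f s : ℂ) • eigenProj D s z⟫_ℂ := by
    refine hasSum_single s fun t ht => ?_
    rw [inner_smul_right, inner_eigenProj_of_ne hD ht.symm hy, mul_zero]
  rw [h1.unique h2, inner_smul_right, inner_eigenProj_of_mem hD hy]

lemma fnCalc_of_mem (hD : IsSelfAdjoint D) (f : ℝ → ℝ) {t : ℝ} {x : H} (hx : x ∈ eigenspace D t) :
    ∃ h : x ∈ (fnCalc D f).domain, fnCalc D f ⟨x, h⟩ = (f t : ℂ) • x := by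
  have h1 : HasSum (fun s : ℝ => (f s : ℂ) • eigenProj D s x) ((f t : ℂ) • eigenProj D t x) := by
    refine hasSum_single t fun s hs => ?_
    rw [eigenProj_of_mem_of_ne hD hs.symm hx, smul_zero]
  rw [eigenProj_of_mem hD hx] at h1
  exact ⟨h1.summable, h1.tsum_eq⟩

lemma bddFnCalc_apply (hD : IsSelfAdjoint D) {f : ℝ → ℝ} {C : ℝ}
    (hC : ∀ t, eigenspace D t ≠ ⊥ → |f t| ≤ C) (x : H) :
    ∃ h : x ∈ (fnCalc D f).domain, bddFnCalc D f x = fnCalc D f ⟨x, h⟩ := by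
  have h := bddFnCalc_toPMap hD hC
  have hx : x ∈ (fnCalc D f).domain := (summable_fnCalc hD hC x).1
  refine ⟨hx, ?_⟩
  exact (LinearPMap.ext_iff.mp h).2 (x := x) (hf := Submodule.mem_top) (hg := hx)

lemma isFn_bddFnCalc (hD : IsSelfAdjoint D) {f : ℝ → ℝ} {C : ℝ}
    (hC : ∀ t, eigenspace D t ≠ ⊥ → |f t| ≤ C) : IsFn D (bddFnCalc D f) f where
  apply t x hx := by
    obtain ⟨h, hx1⟩ := bddFnCalc_apply hD hC x
    rw [hx1, (fnCalc_of_mem hD f hx).2]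
  inner s y hy z := by
    obtain ⟨h, hz⟩ := bddFnCalc_apply hD hC z
    rw [hz, inner_fnCalc hD hy]

lemma norm_bddFnCalc_le (hD : IsSelfAdjoint D) {f : ℝ → ℝ} {C : ℝ} (hC0 : 0 ≤ C)
    (hC : ∀ t, eigenspace D t ≠ ⊥ → |f t| ≤ C) : ‖bddFnCalc D f‖ ≤ C := by
  refine ContinuousLinearMap.opNorm_le_bound _ hC0 fun x => ?_
  obtain ⟨h, hx⟩ := bddFnCalc_apply hD hC x
  rw [hx]
  have := (summable_fnCalc hD hC x).2
  rwa [abs_of_nonneg hC0] at this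

lemma isFn_kerProj (hD : IsSelfAdjoint D) : IsFn D (kerProj D)
    (fun t => if t = 0 then 1 else 0) where
  apply t x hx := by
    split_ifs with h
    · subst h; simp [kerProj, eigenProj_of_mem hD hx]
    · simp [kerProj, eigenProj_of_mem_of_ne hD h hx]
  inner s y hy z := by
    split_ifs with h
    · subst h; simp [kerProj, inner_eigenProj_of_mem hD hy]
    · simp [kerProj, inner_eigenProj_of_ne hD h hy]

lemma IsFn.eq (hD : IsSelfAdjoint D) (hE : IsEssentiallyDiscrete D) {T T' : H →L[ℂ] H}
    {f f' : ℝ → ℝ} (h : IsFn D T f) (h' : IsFn D T' f') (hf : ∀ t, f t = f' t) : T = T' :=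
  ext_eigenspace hD hE fun s t y _ x hx => by rw [h.apply hx, h'.apply hx, hf t]

lemma IsFn.norm_le (hD : IsSelfAdjoint D) (hE : IsEssentiallyDiscrete D) {T : H →L[ℂ] H}
    {f : ℝ → ℝ} (h : IsFn D T f) {C : ℝ} (hC0 : 0 ≤ C)
    (hC : ∀ t, eigenspace D t ≠ ⊥ → |f t| ≤ C) : ‖T‖ ≤ C := by
  rw [h.eq hD hE (isFn_bddFnCalc hD hC) fun _ => rfl]
  exact norm_bddFnCalc_le hD hC0 hC

lemma HasKernel.eq (hD : IsSelfAdjoint D) (hE : IsEssentiallyDiscrete D) {T T' : H →L[ℂ] H}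
    {k k' : ℝ → ℝ → ℝ} (h : HasKernel D a T k) (h' : HasKernel D a T' k')
    (hk : ∀ s t, k s t = k' s t) : T = T' :=
  ext_eigenspace hD hE fun s t y hy x hx => by rw [h hy hx, h' hy hx, hk s t]

lemma hasKernel_commutator (hD : IsSelfAdjoint D) (h : HasBoundedCommutator D a) :
    HasKernel D a (commutator D a) fun s t => s - t := by
  intro s t y x hy hx
  obtain ⟨hx1, hx2⟩ := mem_eigenspace_iff.mp hx
  obtain ⟨hax, h1⟩ := isCommutator_commutator h ⟨x, hx1⟩
  rw [← h1, inner_sub_right, inner_map_of_mem_eigenspace hD hy, hx2, map_smul, inner_smul_right]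
  push_cast
  ring

lemma hasKernel_commutator_absOp (hD : IsSelfAdjoint D) (h : HasBoundedCommutator (absOp D) a) :
    HasKernel D a (commutator (absOp D) a) fun s t => |s| - |t| := by
  intro s t y x hy hx
  obtain ⟨hx1, hx2⟩ := fnCalc_of_mem hD (fun t => |t|) hx
  obtain ⟨hax, h1⟩ := isCommutator_commutator h ⟨x, hx1⟩
  have h2 := inner_fnCalc hD hy ⟨a x, hax⟩
  have hx2' : absOp D ⟨x, hx1⟩ = ((|t| : ℝ) : ℂ) • x := hx2
  have h2' : ⟪y, absOp D ⟨a x, hax⟩⟫_ℂ = ((|s| : ℝ) : ℂ) * ⟪y, a x⟫_ℂ := h2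
  rw [← h1, inner_sub_right, h2', hx2', map_smul, inner_smul_right]
  push_cast
  ring

/-! ### The symbols of the phases -/

/-- The symbol of `F₀`. -/
def phaseSymbol₀ (t : ℝ) : ℝ := (if t = 0 then 1 else 0) + t * |t|⁻¹

/-- The symbol of `F`. -/
def phaseSymbol (t : ℝ) : ℝ := (if t = 0 then 1 else 0) + t / √(1 + t ^ 2)

/-- The symbol of the operator `S (1 - F)`, where `S` is the sign of `D` and `F` has the
symbol `φ`. -/
def defectSymbol (φ : ℝ → ℝ) (t : ℝ) : ℝ := t * |t|⁻¹ * (1 - φ t)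

lemma sqrt_one_add_sq_pos (t : ℝ) : 0 < √(1 + t ^ 2) := Real.sqrt_pos.mpr (by positivity)

lemma sq_sqrt_one_add_sq (t : ℝ) : √(1 + t ^ 2) ^ 2 = 1 + t ^ 2 := Real.sq_sqrt (by positivity)

lemma abs_lt_sqrt_one_add_sq (t : ℝ) : |t| < √(1 + t ^ 2) := by
  rw [← Real.sqrt_sq_eq_abs]
  exact Real.sqrt_lt_sqrt (sq_nonneg t) (by linarith)

lemma abs_mul_abs_inv_le (t : ℝ) : |t * |t|⁻¹| ≤ 1 := by
  rw [abs_mul, abs_inv, abs_abs]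
  exact mul_inv_le_one

lemma abs_div_sqrt_le (t : ℝ) : |t / √(1 + t ^ 2)| ≤ 1 := by
  rw [abs_div, abs_of_pos (sqrt_one_add_sq_pos t), div_le_one (sqrt_one_add_sq_pos t)]
  exact (abs_lt_sqrt_one_add_sq t).le

lemma abs_phaseSymbol₀_le (t : ℝ) : |phaseSymbol₀ t| ≤ 1 := by
  unfold phaseSymbol₀
  split_ifs with h
  · simp [h]
  · simpa using abs_mul_abs_inv_le t

lemma abs_phaseSymbol_le (t : ℝ) : |phaseSymbol t| ≤ 1 := by
  unfold phaseSymbol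
  split_ifs with h
  · simp [h]
  · simpa using abs_div_sqrt_le t

lemma abs_defectSymbol_le {φ : ℝ → ℝ} (hφ : ∀ t, |φ t| ≤ 1) (t : ℝ) : |defectSymbol φ t| ≤ 2 := by
  have h1 := abs_mul_abs_inv_le t
  have h2 : |1 - φ t| ≤ 2 := by
    have := abs_le.mp (hφ t)
    rw [abs_le]
    constructor <;> linarith
  unfold defectSymbol
  rw [abs_mul]
  calc _ ≤ (1 : ℝ) * 2 := by gcongr
    _ = 2 := by norm_num

lemma isFn_phase₀ (hD : IsSelfAdjoint D) : IsFn D (phase₀ D) phaseSymbol₀ :=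
  (isFn_kerProj hD).add (isFn_bddFnCalc hD fun t _ => abs_mul_abs_inv_le t)

lemma isFn_phase (hD : IsSelfAdjoint D) : IsFn D (phase D) phaseSymbol :=
  (isFn_kerProj hD).add (isFn_bddFnCalc hD fun t _ => abs_div_sqrt_le t)

/-- The spectral gap at `0` makes `|t|⁻¹` bounded on the eigenvalues, so `bddFnCalc` is the genuine
operator and not its default value `0`. -/
lemma isFn_absInv (hD : IsSelfAdjoint D) (hE : IsEssentiallyDiscrete D) :
    IsFn D (absInv D) fun t => |t|⁻¹ := by
  obtain ⟨C, -, hC⟩ := exists_abs_inv_le hD hE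
  exact isFn_bddFnCalc hD fun t ht => by simpa using hC t ht

lemma isFn_lineElement (hD : IsSelfAdjoint D) (hE : IsEssentiallyDiscrete D) :
    IsFn D (lineElement D) fun t => t⁻¹ := by
  obtain ⟨C, -, hC⟩ := exists_abs_inv_le hD hE
  exact isFn_bddFnCalc hD fun t ht => by simpa using hC t ht

/-! ### Splitting of the commutator with a phase -/

lemma norm_kerProj_le (D : H →ₗ.[ℂ] H) : ‖kerProj D‖ ≤ 1 :=
  Submodule.starProjection_norm_le _

lemma norm_mul_le_of_le {S T : H →L[ℂ] H} {c e : ℝ} (hS : ‖S‖ ≤ c) (hT : ‖T‖ ≤ e) (hc : 0 ≤ c) :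
    ‖S * T‖ ≤ c * e :=
  (norm_mul_le S T).trans (mul_le_mul hS hT (norm_nonneg T) hc)

lemma norm_one_sub_kerProj_le (hD : IsSelfAdjoint D) (hE : IsEssentiallyDiscrete D) :
    ‖1 - kerProj D‖ ≤ 1 := by
  refine (isFn_one.sub (isFn_kerProj hD)).norm_le hD hE zero_le_one fun t _ => ?_
  simp only [Pi.one_apply]
  split_ifs <;> simp

lemma kerProj_mul_self (hD : IsSelfAdjoint D) (hE : IsEssentiallyDiscrete D) :
    kerProj D * kerProj D = kerProj D :=
  ((isFn_kerProj hD).mul (isFn_kerProj hD)).eq hD hE (isFn_kerProj hD) fun t => by split_ifs <;> simp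

/-- The indicator of `s = 0` selects one of the two terms. For `s = 0` the first one is `t * (t *
|t|⁻¹) * (1 - φ t) * |t|⁻¹ = 1 - φ t` when `t ≠ 0`; for `s ≠ 0` the terms `|t| * φ t` cancel in the
second one. -/
lemma kernel_identity_left {φ : ℝ → ℝ} (h0 : φ 0 = 1) (s t : ℝ) :
    φ s - φ t = -((if s = 0 then 1 else 0) * (s - t) * defectSymbol φ t) * |t|⁻¹ +
      |s|⁻¹ * ((1 - if s = 0 then 1 else 0) * (|s| * φ s - |t| * φ t - (|s| - |t|) * φ t)) := by
  unfold defectSymbol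
  split_ifs with hs
  · subst hs
    rcases eq_or_ne t 0 with rfl | ht
    · simp
    · have ht' : |t| ≠ 0 := abs_ne_zero.mpr ht
      field_simp
      rw [sq_abs]
      field_simp
      simp [h0, mul_comm]
  · have hs' : |s| ≠ 0 := abs_ne_zero.mpr hs
    field_simp
    ring

lemma kernel_identity_right {φ : ℝ → ℝ} (h0 : φ 0 = 1) (s t : ℝ) :
    φ s - φ t = (|s| * φ s - |t| * φ t - φ s * (|s| - |t|)) * (1 - if t = 0 then 1 else 0) * |t|⁻¹ +
      |s|⁻¹ * -(defectSymbol φ s * (s - t) * if t = 0 then 1 else 0) := by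
  unfold defectSymbol
  split_ifs with ht
  · subst ht
    rcases eq_or_ne s 0 with rfl | hs
    · simp
    · have hs' : |s| ≠ 0 := abs_ne_zero.mpr hs
      field_simp
      rw [sq_abs]
      field_simp
      rw [h0]
      ring
  · have ht' : |t| ≠ 0 := abs_ne_zero.mpr ht
    field_simp
    ring

/-- `[F, a] = α |D|⁻¹ + |D|⁻¹ β`, for `F = φ(D)` with `φ 0 = 1`, where `c` stands for
`[|D| F, a]` and `d`, `b` for `[D, a]`, `[|D|, a]`. -/
lemma commutator_eq_left (hD : IsSelfAdjoint D) (hE : IsEssentiallyDiscrete D) {φ : ℝ → ℝ}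
    (h0 : φ 0 = 1) {F G b c d : H →L[ℂ] H} (hF : IsFn D F φ) (hG : IsFn D G (defectSymbol φ))
    (hd : HasKernel D a d fun s t => s - t) (hb : HasKernel D a b fun s t => |s| - |t|)
    (hc : HasKernel D a c fun s t => |s| * φ s - |t| * φ t) :
    F * a - a * F = -(kerProj D * d * G) * absInv D +
      absInv D * ((1 - kerProj D) * (c - b * F)) :=
  hF.commutator_kernel.eq hD hE
    (((((isFn_kerProj hD).mul_kernel hd).mul_fn hG).neg.mul_fn (isFn_absInv hD hE)).add
      ((isFn_absInv hD hE).mul_kernel ((isFn_one.sub (isFn_kerProj hD)).mul_kernel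
        (hc.sub (hb.mul_fn hF)))))
    (kernel_identity_left h0)

/-- The mirror image of `commutator_eq_left`. -/
lemma commutator_eq_right (hD : IsSelfAdjoint D) (hE : IsEssentiallyDiscrete D) {φ : ℝ → ℝ}
    (h0 : φ 0 = 1) {F G b c d : H →L[ℂ] H} (hF : IsFn D F φ) (hG : IsFn D G (defectSymbol φ))
    (hd : HasKernel D a d fun s t => s - t) (hb : HasKernel D a b fun s t => |s| - |t|)
    (hc : HasKernel D a c fun s t => |s| * φ s - |t| * φ t) :
    F * a - a * F = (c - F * b) * (1 - kerProj D) * absInv D +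
      absInv D * -(G * d * kerProj D) :=
  hF.commutator_kernel.eq hD hE
    ((((hc.sub (hF.mul_kernel hb)).mul_fn (isFn_one.sub (isFn_kerProj hD))).mul_fn
      (isFn_absInv hD hE)).add
      ((isFn_absInv hD hE).mul_kernel ((hG.mul_kernel hd).mul_fn (isFn_kerProj hD)).neg))
    (kernel_identity_right h0)

/-! ### The sharp estimate -/

/-- The symbol of `√(1 + D²) - |D|` cut off to the orthogonal complement of the kernel. -/
def gapSymbol (t : ℝ) : ℝ := if t = 0 then 0 else √(1 + t ^ 2) - |t|

/-- The symbol of `|D| / √(1 + D²)`. -/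
def absPhaseSymbol (t : ℝ) : ℝ := |t| / √(1 + t ^ 2)

lemma sqrt_one_add_sq_sub_antitone {l t : ℝ} (hl : 0 < l) (h : l ≤ t) :
    √(1 + t ^ 2) - t ≤ √(1 + l ^ 2) - l := by
  have h1 := sq_sqrt_one_add_sq t
  have h2 := sq_sqrt_one_add_sq l
  have h3 := sqrt_one_add_sq_pos t
  have h4 := sqrt_one_add_sq_pos l
  have h5 := abs_lt_sqrt_one_add_sq t
  have h6 := abs_lt_sqrt_one_add_sq l
  rw [abs_of_pos (hl.trans_le h)] at h5
  rw [abs_of_pos hl] at h6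
  nlinarith

lemma abs_gapSymbol_le {l t : ℝ} (hl : 0 < l) (h : t ≠ 0 → l ≤ |t|) :
    |gapSymbol t| ≤ √(1 + l ^ 2) - l := by
  have h6 := abs_lt_sqrt_one_add_sq l
  rw [abs_of_pos hl] at h6
  unfold gapSymbol
  split_ifs with ht
  · rw [abs_zero]; linarith
  · rw [abs_of_nonneg (sub_nonneg.mpr (abs_lt_sqrt_one_add_sq t).le)]
    have := sqrt_one_add_sq_sub_antitone hl (h ht)
    rwa [sq_abs] at this

lemma abs_gapSymbol_le_one (t : ℝ) : |gapSymbol t| ≤ 1 := by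
  unfold gapSymbol
  split_ifs with ht
  · simp
  · have h1 := sq_sqrt_one_add_sq t
    have h2 := abs_lt_sqrt_one_add_sq t
    rw [abs_of_nonneg (sub_nonneg.mpr h2.le)]
    have := abs_nonneg t
    nlinarith [sq_abs t]

lemma abs_absPhaseSymbol_le (t : ℝ) : |absPhaseSymbol t| ≤ 1 := by
  simpa [absPhaseSymbol, abs_div] using abs_div_sqrt_le t

/-- The commutator of `a` with `√(1 + D²)`, compressed to the orthogonal complement of the kernel,
is controlled by the commutator with `|D|`. -/
lemma exists_norm_sqrt_commutator_le (hD : IsSelfAdjoint D) (hE : IsEssentiallyDiscrete D)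
    {b : H →L[ℂ] H} (hb : HasKernel D a b fun s t => |s| - |t|) :
    ∃ c : H →L[ℂ] H,
      (HasKernel D a c fun s t => (1 - if s = 0 then 1 else 0) *
        ((√(1 + s ^ 2) - √(1 + t ^ 2)) * (1 - if t = 0 then 1 else 0))) ∧
      ∀ l : ℝ, 0 < l → (∀ t, eigenspace D t ≠ ⊥ → t ≠ 0 → l ≤ |t|) →
        ‖c‖ ≤ √(1 + (l ^ 2)⁻¹) * ‖b‖ := by
  set X := bddFnCalc D gapSymbol
  have hX : IsFn D X gapSymbol := isFn_bddFnCalc hD fun t _ => abs_gapSymbol_le_one t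
  set Q := 1 - kerProj D
  have hQ : IsFn D Q _ := isFn_one.sub (isFn_kerProj hD)
  set e := Q * ((X * a - a * X) * Q)
  have hek := hQ.mul_kernel ((hX.commutator_kernel (a := a)).mul_fn hQ)
  have hbk := hQ.mul_kernel (hb.mul_fn hQ)
  -- The symbol `x` of `X` satisfies `1 - x² = 2|t|x` away from `0`; this identity is the commutator
  -- of `a` with `X⁻¹ - X = 2|D|`, multiplied by `X` on both sides.
  have heq : e = -(X * (e * X)) - (X * (b * X) + X * (b * X)) := by
    refine hek.eq hD hE ((hX.mul_kernel (hek.mul_fn hX)).neg.sub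
      ((hX.mul_kernel (hb.mul_fn hX)).add (hX.mul_kernel (hb.mul_fn hX)))) fun s t => ?_
    simp only [Pi.one_apply, gapSymbol]
    split_ifs with hs ht
    · simp
    · simp
    · simp
    · have h1 := sq_sqrt_one_add_sq t
      have h2 := sq_sqrt_one_add_sq s
      rw [← sq_abs t] at h1
      rw [← sq_abs s] at h2
      rw [← sq_abs t, ← sq_abs s]
      linear_combination (√(1 + |t| ^ 2) - |t|) * h2 - (√(1 + |s| ^ 2) - |s|) * h1
  refine ⟨Q * (b * Q) + e, fun s t y x hy hx => ?_, fun l hl hlt => ?_⟩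
  · rw [(hbk.add hek) hy hx]
    congr 2
    simp only [Pi.one_apply, gapSymbol]
    split_ifs <;> ring
  · set q := √(1 + l ^ 2) - l with hq
    -- Setting the symbol to `0` at the kernel is what allows `q < 1`: the uncut function takes the
    -- value `1` there.
    have hXq : ‖X‖ ≤ q := by
      refine hX.norm_le hD hE ?_ fun t ht => abs_gapSymbol_le hl (hlt t ht)
      exact (abs_nonneg _).trans (abs_gapSymbol_le hl fun _ => (le_abs_self l))
    have h1 := sq_sqrt_one_add_sq l
    have h2 := abs_lt_sqrt_one_add_sq l
    rw [abs_of_pos hl] at h2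
    have hq0 : 0 < q := by linarith
    have hq1 : q ^ 2 + 2 * l * q = 1 := by rw [hq]; linear_combination h1
    have hconj : ∀ T : H →L[ℂ] H, ‖X * (T * X)‖ ≤ q ^ 2 * ‖T‖ := by
      intro T
      calc ‖X * (T * X)‖ ≤ q * (‖T‖ * q) :=
            norm_mul_le_of_le hXq (norm_mul_le_of_le le_rfl hXq (norm_nonneg T)) hq0.le
        _ = q ^ 2 * ‖T‖ := by ring
    have he1 : ‖e‖ ≤ q ^ 2 * ‖e‖ + 2 * q ^ 2 * ‖b‖ := by
      have h3 : ‖-(X * (e * X)) - (X * (b * X) + X * (b * X))‖ ≤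
          ‖X * (e * X)‖ + (‖X * (b * X)‖ + ‖X * (b * X)‖) := by
        refine (norm_sub_le _ _).trans ?_
        rw [norm_neg]
        gcongr
        exact norm_add_le _ _
      rw [← heq] at h3
      linarith [hconj e, hconj b]
    have hQ1 : ‖Q‖ ≤ 1 := norm_one_sub_kerProj_le hD hE
    have hbQ : ‖Q * (b * Q)‖ ≤ ‖b‖ := by
      have := norm_mul_le_of_le hQ1 (norm_mul_le_of_le (le_refl ‖b‖) hQ1 (norm_nonneg b)) zero_le_one
      simpa using this
    have hroot : √(1 + (l ^ 2)⁻¹) = √(1 + l ^ 2) / l := by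
      rw [show 1 + (l ^ 2)⁻¹ = (1 + l ^ 2) / l ^ 2 by field_simp; ring, Real.sqrt_div (by positivity),
        Real.sqrt_sq hl.le]
    -- Absorbing `q² ‖e‖` on the left leaves the factor `1 - q² = 2lq`. The resulting constant `1 +
    -- q / l` equals `√(1 + l²) / l`.
    have he2 : l * ‖e‖ ≤ q * ‖b‖ := by
      have h3 : q * (2 * (l * ‖e‖)) ≤ q * (2 * (q * ‖b‖)) := by
        have h4 : (1 - q ^ 2) * ‖e‖ ≤ 2 * q ^ 2 * ‖b‖ := by linarith
        rw [show 1 - q ^ 2 = 2 * l * q by linarith] at h4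
        linarith
      have := le_of_mul_le_mul_left h3 hq0
      linarith
    rw [hroot, div_mul_eq_mul_div, le_div_iff₀ hl]
    have h4 : ‖Q * (b * Q) + e‖ ≤ ‖b‖ + ‖e‖ := (norm_add_le _ _).trans (by gcongr)
    have h5 : √(1 + l ^ 2) = l + q := by rw [hq]; ring
    rw [h5]
    nlinarith

/-- The bounded difference between `D` and `|D| F`. -/
def phaseRemainder (t : ℝ) : ℝ := t - |t| * phaseSymbol t

lemma abs_phaseRemainder_le (t : ℝ) : |phaseRemainder t| ≤ 1 := by
  have h1 := sq_sqrt_one_add_sq t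
  have h2 := sqrt_one_add_sq_pos t
  have h3 := abs_lt_sqrt_one_add_sq t
  have h4 := abs_nonneg t
  rcases eq_or_ne t 0 with rfl | ht
  · simp [phaseRemainder]
  have h5 : phaseRemainder t = t / √(1 + t ^ 2) * (√(1 + t ^ 2) - |t|) := by
    simp only [phaseRemainder, phaseSymbol, ht, if_false]
    field_simp
    ring
  rw [h5, abs_mul, abs_of_pos (sub_pos.mpr h3)]
  have h6 : √(1 + t ^ 2) - |t| ≤ 1 := by nlinarith [sq_abs t]
  calc _ ≤ (1 : ℝ) * 1 := mul_le_mul (abs_div_sqrt_le t) h6 (sub_pos.mpr h3).le zero_le_one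
    _ = 1 := one_mul 1

lemma phaseSymbol_zero : phaseSymbol 0 = 1 := by simp [phaseSymbol]

lemma phaseSymbol₀_zero : phaseSymbol₀ 0 = 1 := by simp [phaseSymbol₀]

lemma exists_norm_abs_phase_commutator_le (hD : IsSelfAdjoint D) {d : H →L[ℂ] H}
    (hd : HasKernel D a d fun s t => s - t) :
    ∃ c : H →L[ℂ] H, HasKernel D a c (fun s t => |s| * phaseSymbol s - |t| * phaseSymbol t) ∧
      ‖c‖ ≤ ‖d‖ + 2 * ‖a‖ := by
  set R := bddFnCalc D phaseRemainder
  have hR : IsFn D R phaseRemainder := isFn_bddFnCalc hD fun t _ => abs_phaseRemainder_le t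
  have hR1 : ‖R‖ ≤ 1 := norm_bddFnCalc_le hD zero_le_one fun t _ => abs_phaseRemainder_le t
  refine ⟨d - (R * a - a * R), fun s t y x hy hx => ?_, ?_⟩
  · rw [(hd.sub hR.commutator_kernel) hy hx]
    congr 2
    unfold phaseRemainder
    ring
  · have h1 : ‖R * a‖ ≤ 1 * ‖a‖ := norm_mul_le_of_le hR1 le_rfl zero_le_one
    have h2 : ‖a * R‖ ≤ ‖a‖ * 1 := norm_mul_le_of_le le_rfl hR1 (norm_nonneg a)
    have h3 := norm_sub_le d (R * a - a * R)
    have h4 := norm_sub_le (R * a) (a * R)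
    linarith

/-! ### Entrywise identities and norm bounds for the sharp estimate -/

lemma absPhaseSymbol_kernel_left (s t : ℝ) :
    (1 - if s = 0 then 1 else 0) * (|s| * phaseSymbol s - |t| * phaseSymbol t -
        (|s| - |t|) * phaseSymbol t) * (1 - if t = 0 then 1 else 0) =
      absPhaseSymbol s * ((1 - if s = 0 then 1 else 0) * ((s - t) * (1 - if t = 0 then 1 else 0)) -
        (1 - if s = 0 then 1 else 0) *
          ((√(1 + s ^ 2) - √(1 + t ^ 2)) * (1 - if t = 0 then 1 else 0)) * phaseSymbol t) := by
  have h1 := sqrt_one_add_sq_pos s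
  have h2 := sqrt_one_add_sq_pos t
  unfold phaseSymbol absPhaseSymbol
  split_ifs <;> field_simp <;> ring

lemma absPhaseSymbol_kernel_right (s t : ℝ) :
    (1 - if s = 0 then 1 else 0) * ((|s| * phaseSymbol s - |t| * phaseSymbol t -
        phaseSymbol s * (|s| - |t|)) * (1 - if t = 0 then 1 else 0)) =
      ((1 - if s = 0 then 1 else 0) * ((s - t) * (1 - if t = 0 then 1 else 0)) -
        phaseSymbol s * ((1 - if s = 0 then 1 else 0) *
          ((√(1 + s ^ 2) - √(1 + t ^ 2)) * (1 - if t = 0 then 1 else 0)))) * absPhaseSymbol t := by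
  have h1 := sqrt_one_add_sq_pos s
  have h2 := sqrt_one_add_sq_pos t
  unfold phaseSymbol absPhaseSymbol
  split_ifs <;> field_simp <;> ring

/-- On `ker D` the operator `c - b F` reduces to a multiple of `[D, a]` alone: with `t = 0` and `φ 0
= 1` the entry is `|s| * (φ s - 1)`, which is `-s` times the defect symbol. -/
lemma defectSymbol_kernel_left {φ : ℝ → ℝ} (h0 : φ 0 = 1) (s t : ℝ) :
    (1 - if s = 0 then 1 else 0) * (|s| * φ s - |t| * φ t - (|s| - |t|) * φ t) *
        (if t = 0 then 1 else 0) = -(defectSymbol φ s * (s - t) * if t = 0 then 1 else 0) := by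
  unfold defectSymbol
  split_ifs with hs ht
  · simp [hs, h0]
  · simp
  · have hs' : |s| ≠ 0 := abs_ne_zero.mpr hs
    subst_vars
    field_simp
    rw [h0, abs_zero]
    linear_combination (φ s - 1) * sq_abs s
  · simp

lemma defectSymbol_kernel_right {φ : ℝ → ℝ} (h0 : φ 0 = 1) (s t : ℝ) :
    (if s = 0 then 1 else 0) * ((|s| * φ s - |t| * φ t - φ s * (|s| - |t|)) *
        (1 - if t = 0 then 1 else 0)) = -((if s = 0 then 1 else 0) * (s - t) * defectSymbol φ t) := by
  unfold defectSymbol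
  split_ifs with hs ht
  · simp [ht]
  · have ht' : |t| ≠ 0 := abs_ne_zero.mpr ht
    subst_vars
    field_simp
    rw [h0, abs_zero]
    linear_combination (1 - φ t) * sq_abs t
  · simp
  · simp

section

variable {F G b c d : H →L[ℂ] H}

/-- The operator is split on the right by `P₀` and `1 - P₀`. The first piece is `-G d P₀`, of norm
at most `2‖d‖`; the second factors through `|D| / √(1 + D²)` and costs `‖d‖` plus the commutator
with `√(1 + D²)`. This accounts for the constant `3`. -/
lemma norm_left_le (hD : IsSelfAdjoint D) (hE : IsEssentiallyDiscrete D)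
    (hF : IsFn D F phaseSymbol) (hF1 : ‖F‖ ≤ 1) (hG : IsFn D G (defectSymbol phaseSymbol))
    (hG2 : ‖G‖ ≤ 2) (hd : HasKernel D a d fun s t => s - t)
    (hb : HasKernel D a b fun s t => |s| - |t|)
    (hc : HasKernel D a c fun s t => |s| * phaseSymbol s - |t| * phaseSymbol t)
    {l : ℝ} (hl : 0 < l) (hlt : ∀ t, eigenspace D t ≠ ⊥ → t ≠ 0 → l ≤ |t|) :
    ‖(1 - kerProj D) * (c - b * F)‖ ≤ 3 * ‖d‖ + √(1 + (l ^ 2)⁻¹) * ‖b‖ := by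
  obtain ⟨c', hc', hc'l⟩ := exists_norm_sqrt_commutator_le hD hE hb
  set N := bddFnCalc D absPhaseSymbol
  have hN : IsFn D N absPhaseSymbol := isFn_bddFnCalc hD fun t _ => abs_absPhaseSymbol_le t
  have hN1 : ‖N‖ ≤ 1 := norm_bddFnCalc_le hD zero_le_one fun t _ => abs_absPhaseSymbol_le t
  have hP := isFn_kerProj hD
  have hQ := isFn_one.sub hP
  have hQ1 := norm_one_sub_kerProj_le hD hE
  have hT := hQ.mul_kernel (hc.sub (hb.mul_fn hF))
  have hU : (1 - kerProj D) * (c - b * F) * kerProj D = -(G * d * kerProj D) :=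
    (hT.mul_fn hP).eq hD hE ((hG.mul_kernel hd).mul_fn hP).neg
      (defectSymbol_kernel_left phaseSymbol_zero)
  have hV : (1 - kerProj D) * (c - b * F) * (1 - kerProj D) =
      N * ((1 - kerProj D) * (d * (1 - kerProj D)) - c' * F) :=
    (hT.mul_fn hQ).eq hD hE
      (hN.mul_kernel ((hQ.mul_kernel (hd.mul_fn hQ)).sub (hc'.mul_fn hF)))
      absPhaseSymbol_kernel_left
  have hu : ‖-(G * d * kerProj D)‖ ≤ 2 * ‖d‖ * 1 := by
    rw [norm_neg]
    exact norm_mul_le_of_le (norm_mul_le_of_le hG2 le_rfl zero_le_two) (norm_kerProj_le D)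
      (by positivity)
  have hv : ‖N * ((1 - kerProj D) * (d * (1 - kerProj D)) - c' * F)‖ ≤
      1 * (1 * (‖d‖ * 1) + √(1 + (l ^ 2)⁻¹) * ‖b‖ * 1) := by
    refine norm_mul_le_of_le hN1 ((norm_sub_le _ _).trans (add_le_add ?_ ?_)) zero_le_one
    · exact norm_mul_le_of_le hQ1 (norm_mul_le_of_le le_rfl hQ1 (norm_nonneg d)) zero_le_one
    · exact norm_mul_le_of_le (hc'l l hl hlt) hF1 (by positivity)
  set T := (1 - kerProj D) * (c - b * F)
  have hsum : T = T * kerProj D + T * (1 - kerProj D) := by rw [mul_sub, mul_one, add_sub_cancel]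
  have := norm_add_le (T * kerProj D) (T * (1 - kerProj D))
  rw [← hsum, hU, hV] at this
  linarith

lemma norm_right_le (hD : IsSelfAdjoint D) (hE : IsEssentiallyDiscrete D)
    (hF : IsFn D F phaseSymbol) (hF1 : ‖F‖ ≤ 1) (hG : IsFn D G (defectSymbol phaseSymbol))
    (hG2 : ‖G‖ ≤ 2) (hd : HasKernel D a d fun s t => s - t)
    (hb : HasKernel D a b fun s t => |s| - |t|)
    (hc : HasKernel D a c fun s t => |s| * phaseSymbol s - |t| * phaseSymbol t)
    {l : ℝ} (hl : 0 < l) (hlt : ∀ t, eigenspace D t ≠ ⊥ → t ≠ 0 → l ≤ |t|) :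
    ‖(c - F * b) * (1 - kerProj D)‖ ≤ 3 * ‖d‖ + √(1 + (l ^ 2)⁻¹) * ‖b‖ := by
  obtain ⟨c', hc', hc'l⟩ := exists_norm_sqrt_commutator_le hD hE hb
  set N := bddFnCalc D absPhaseSymbol
  have hN : IsFn D N absPhaseSymbol := isFn_bddFnCalc hD fun t _ => abs_absPhaseSymbol_le t
  have hN1 : ‖N‖ ≤ 1 := norm_bddFnCalc_le hD zero_le_one fun t _ => abs_absPhaseSymbol_le t
  have hP := isFn_kerProj hD
  have hQ := isFn_one.sub hP
  have hQ1 := norm_one_sub_kerProj_le hD hE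
  have hT := (hc.sub (hF.mul_kernel hb)).mul_fn hQ
  have hU : kerProj D * ((c - F * b) * (1 - kerProj D)) = -(kerProj D * d * G) :=
    (hP.mul_kernel hT).eq hD hE ((hP.mul_kernel hd).mul_fn hG).neg
      (defectSymbol_kernel_right phaseSymbol_zero)
  have hV : (1 - kerProj D) * ((c - F * b) * (1 - kerProj D)) =
      ((1 - kerProj D) * (d * (1 - kerProj D)) - F * c') * N :=
    (hQ.mul_kernel hT).eq hD hE
      (((hQ.mul_kernel (hd.mul_fn hQ)).sub (hF.mul_kernel hc')).mul_fn hN)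
      absPhaseSymbol_kernel_right
  have hu : ‖-(kerProj D * d * G)‖ ≤ 1 * ‖d‖ * 2 := by
    rw [norm_neg]
    exact norm_mul_le_of_le (norm_mul_le_of_le (norm_kerProj_le D) le_rfl zero_le_one) hG2
      (by positivity)
  have hv : ‖((1 - kerProj D) * (d * (1 - kerProj D)) - F * c') * N‖ ≤
      (1 * (‖d‖ * 1) + 1 * (√(1 + (l ^ 2)⁻¹) * ‖b‖)) * 1 := by
    refine norm_mul_le_of_le ((norm_sub_le _ _).trans (add_le_add ?_ ?_)) hN1 (by positivity)
    · exact norm_mul_le_of_le hQ1 (norm_mul_le_of_le le_rfl hQ1 (norm_nonneg d)) zero_le_one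
    · exact norm_mul_le_of_le hF1 (hc'l l hl hlt) zero_le_one
  set T := (c - F * b) * (1 - kerProj D)
  have hsum : T = kerProj D * T + (1 - kerProj D) * T := by rw [sub_mul, one_mul, add_sub_cancel]
  have := norm_add_le (kerProj D * T) ((1 - kerProj D) * T)
  rw [← hsum, hU, hV] at this
  linarith

end

end QuantumDifferential

end

open scoped ENNReal InnerProductSpace

noncomputable section

namespace QuantumDifferential

/-! ### Singular values -/

section

variable {H : Type*} [NormedAddCommGroup H] [InnerProductSpace ℂ H]

lemma singularValue_nonneg (k : ℕ) (T : H →L[ℂ] H) : 0 ≤ singularValue k T :=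
  Real.iInf_nonneg fun _ => ContinuousLinearMap.opNorm_nonneg _

lemma singularValue_le {k : ℕ} {T : H →L[ℂ] H} (E : Submodule ℂ H) [FiniteDimensional ℂ E]
    (hE : Module.finrank ℂ E ≤ k) {C : ℝ} (hC : 0 ≤ C) (h : ∀ x ∈ Eᗮ, ‖T x‖ ≤ C * ‖x‖) :
    singularValue k T ≤ C := by
  refine (ciInf_le ⟨0, ?_⟩ (⟨E, inferInstance, hE⟩ :
    {E : Submodule ℂ H // FiniteDimensional ℂ E ∧ Module.finrank ℂ E ≤ k})).trans ?_
  · rintro _ ⟨E, rfl⟩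
    exact ContinuousLinearMap.opNorm_nonneg _
  · exact ContinuousLinearMap.opNorm_le_bound _ hC fun x => h x x.2

lemma le_singularValue {k : ℕ} {T : H →L[ℂ] H} {C : ℝ}
    (h : ∀ E : Submodule ℂ H, FiniteDimensional ℂ E → Module.finrank ℂ E ≤ k →
      C ≤ ‖T ∘L Eᗮ.subtypeL‖) : C ≤ singularValue k T := by
  have : Nonempty {E : Submodule ℂ H // FiniteDimensional ℂ E ∧ Module.finrank ℂ E ≤ k} :=
    ⟨⊥, inferInstance, by simp⟩
  exact le_ciInf fun E => h E.1 E.2.1 E.2.2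

lemma norm_apply_le_of_mem {T : H →L[ℂ] H} {E : Submodule ℂ H} {x : H} (hx : x ∈ Eᗮ) :
    ‖T x‖ ≤ ‖T ∘L Eᗮ.subtypeL‖ * ‖x‖ :=
  (T ∘L Eᗮ.subtypeL).le_opNorm ⟨x, hx⟩

lemma singularValue_mul_le (k : ℕ) (S T : H →L[ℂ] H) :
    singularValue k (S * T) ≤ ‖S‖ * singularValue k T := by
  unfold singularValue
  rw [Real.mul_iInf_of_nonneg (norm_nonneg S)]
  refine ciInf_mono ⟨0, ?_⟩ fun E => ?_
  · rintro _ ⟨E, rfl⟩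
    exact ContinuousLinearMap.opNorm_nonneg _
  · exact ContinuousLinearMap.opNorm_comp_le S (T ∘L (E.1)ᗮ.subtypeL)

lemma singularValue_mul_add_mul_le [CompleteSpace H] (k : ℕ) (α β T : H →L[ℂ] H) :
    singularValue (2 * k) (α * T + T * β) ≤ (‖α‖ + ‖β‖) * singularValue k T := by
  conv_rhs => unfold singularValue
  rw [Real.mul_iInf_of_nonneg (by positivity)]
  have : Nonempty {E : Submodule ℂ H // FiniteDimensional ℂ E ∧ Module.finrank ℂ E ≤ k} :=
    ⟨⊥, inferInstance, by simp⟩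
  refine le_ciInf fun ⟨E, hfin, hk⟩ => ?_
  -- A vector orthogonal to `β* E` is sent by `β` into `Eᗮ`. One test space thus controls both terms
  -- at the price of doubling its dimension.
  set E' := E.map (ContinuousLinearMap.adjoint β : H →ₗ[ℂ] H)
  have hdim : Module.finrank ℂ (E ⊔ E' : Submodule ℂ H) ≤ 2 * k := by
    have h1 := Submodule.finrank_add_le_finrank_add_finrank E E'
    have h2 : Module.finrank ℂ E' ≤ Module.finrank ℂ E := Submodule.finrank_map_le _ _
    omega
  refine singularValue_le (E ⊔ E') hdim (by positivity) fun x hx => ?_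
  have hx1 : x ∈ Eᗮ := Submodule.orthogonal_le le_sup_left hx
  have hx2 : β x ∈ Eᗮ := by
    intro u hu
    rw [← ContinuousLinearMap.adjoint_inner_left]
    exact hx _ (le_sup_right (a := E) (Submodule.mem_map_of_mem hu))
  set m := ‖T ∘L Eᗮ.subtypeL‖
  calc ‖α (T x) + T (β x)‖ ≤ ‖α (T x)‖ + ‖T (β x)‖ := norm_add_le _ _
    _ ≤ ‖α‖ * (m * ‖x‖) + m * (‖β‖ * ‖x‖) := by
      gcongr
      · exact α.le_opNorm_of_le (norm_apply_le_of_mem hx1)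
      · exact (norm_apply_le_of_mem hx2).trans (by gcongr; exact β.le_opNorm x)
    _ = (‖α‖ + ‖β‖) * m * ‖x‖ := by ring

/-- The span of the eigenspaces of `T` for the eigenvalues in `(0, s]`. -/
def spectralSubspace (T : H →ₗ.[ℂ] H) (s : ℝ) : Submodule ℂ H :=
  ⨆ t ∈ Set.Ioc (0 : ℝ) s, eigenspace T t

/-- Otherwise the orthogonal projection to `E` would embed `V` in a space of dimension at most `k`.
The rank is a cardinal since `V` may be infinite-dimensional. -/
lemma exists_mem_orthogonal_ne_zero {V E : Submodule ℂ H} [FiniteDimensional ℂ E] {k : ℕ}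
    (hE : Module.finrank ℂ E ≤ k) (hV : ((k + 1 : ℕ) : Cardinal) ≤ Module.rank ℂ V) :
    ∃ x ∈ V, x ∈ Eᗮ ∧ x ≠ 0 := by
  by_contra! h
  have hinj : Function.Injective ((E.orthogonalProjectionOnto : H →ₗ[ℂ] E) ∘ₗ V.subtype) := by
    rw [← LinearMap.ker_eq_bot, LinearMap.ker_eq_bot']
    intro x hx
    have hx' : E.orthogonalProjectionOnto (x : H) = 0 := hx
    rw [Submodule.orthogonalProjectionOnto_eq_zero_iff] at hx'
    exact Subtype.ext (h x x.2 hx')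
  have h1 := (hV.trans (LinearMap.rank_le_of_injective _ hinj)).trans_eq
    (Module.finrank_eq_rank ℂ E).symm
  have h2 : k + 1 ≤ Module.finrank ℂ E := by exact_mod_cast h1
  omega

end

variable {H : Type*} [NormedAddCommGroup H] [InnerProductSpace ℂ H] [CompleteSpace H]
  {D : H →ₗ.[ℂ] H}

/-! ### Spectral subspaces of `|D|` and the singular values of `|D|⁻¹` -/

lemma eigenspace_le_eigenspace_absOp (hD : IsSelfAdjoint D) (t : ℝ) :
    eigenspace D t ≤ eigenspace (absOp D) |t| := fun _ hx =>
  mem_eigenspace_iff.mpr (fnCalc_of_mem hD (fun t => |t|) hx)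

lemma inner_eq_zero_of_mem_eigenspace_absOp (hD : IsSelfAdjoint D) {r t : ℝ} {x y : H}
    (hy : y ∈ eigenspace D r) (hx : x ∈ eigenspace (absOp D) t) (hrt : |r| ≠ t) :
    ⟪y, x⟫_ℂ = 0 := by
  obtain ⟨hx1, hx2⟩ := mem_eigenspace_iff.mp hx
  have h1 : ⟪y, absOp D ⟨x, hx1⟩⟫_ℂ = ((|r| : ℝ) : ℂ) * ⟪y, x⟫_ℂ := inner_fnCalc hD hy ⟨x, hx1⟩
  rw [hx2, inner_smul_right, ← sub_eq_zero, ← sub_mul] at h1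
  refine (mul_eq_zero.mp h1).resolve_left (sub_ne_zero.mpr ?_)
  exact_mod_cast hrt.symm

/-- On the spectral subspace `|D|⁻¹` is inverted by `|D|` truncated at `s`, an operator of norm at
most `s`. Testing against eigenvectors of `D` avoids decomposing those of `|D|`. -/
lemma norm_le_mul_absInv (hD : IsSelfAdjoint D) (hE : IsEssentiallyDiscrete D) {s : ℝ} (hs : 0 < s)
    {x : H} (hx : x ∈ spectralSubspace (absOp D) s) : ‖x‖ ≤ s * ‖absInv D x‖ := by
  set f : ℝ → ℝ := fun t => if |t| ≤ s then |t| else 0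
  have hf : ∀ t, eigenspace D t ≠ ⊥ → |f t| ≤ s := by
    intro t _
    simp only [f]
    split_ifs with h
    · rwa [abs_abs]
    · rw [abs_zero]; exact hs.le
  set T := bddFnCalc D f
  have hT : IsFn D T f := isFn_bddFnCalc hD hf
  have hTx : T (absInv D x) = x := by
    have hle : spectralSubspace (absOp D) s ≤
        LinearMap.eqLocus ((T * absInv D : H →L[ℂ] H) : H →ₗ[ℂ] H) LinearMap.id := by
      refine iSup₂_le fun t ht v hv => ?_
      change (T * absInv D) v = v
      rw [← sub_eq_zero]
      refine eq_zero_of_inner_eigenspace hD hE fun r y hy => ?_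
      rw [inner_sub_right, (hT.mul (isFn_absInv hD hE)).inner hy]
      rcases eq_or_ne |r| t with rfl | hr
      · have h1 : f r * |r|⁻¹ = 1 := by
          simp only [f, if_pos ht.2]
          exact mul_inv_cancel₀ ht.1.ne'
        rw [h1, Complex.ofReal_one, one_mul, sub_self]
      · rw [inner_eq_zero_of_mem_eigenspace_absOp hD hy hv hr, mul_zero, sub_zero]
    exact hle hx
  calc ‖x‖ = ‖T (absInv D x)‖ := by rw [hTx]
    _ ≤ s * ‖absInv D x‖ := T.le_of_opNorm_le (norm_bddFnCalc_le hD hs.le hf) _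

/-- On this complement `|D|⁻¹` agrees with its truncation to `|t| > s`, of norm at most `s⁻¹`. The
kernel of `D` does no harm, as `|0|⁻¹ = 0`. -/
lemma norm_absInv_le_of_mem_orthogonal (hD : IsSelfAdjoint D) (hE : IsEssentiallyDiscrete D)
    {s : ℝ} (hs : 0 < s) {x : H} (hx : x ∈ (spectralSubspace (absOp D) s)ᗮ) :
    ‖absInv D x‖ ≤ s⁻¹ * ‖x‖ := by
  set f : ℝ → ℝ := fun t => if |t| ≤ s then 0 else |t|⁻¹
  have hf : ∀ t, eigenspace D t ≠ ⊥ → |f t| ≤ s⁻¹ := by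
    intro t _
    simp only [f]
    split_ifs with h
    · rw [abs_zero]; positivity
    · rw [abs_inv, abs_abs]
      exact inv_anti₀ hs (not_le.mp h).le
  have hT : IsFn D (bddFnCalc D f) f := isFn_bddFnCalc hD hf
  have hTx : absInv D x = bddFnCalc D f x := by
    rw [← sub_eq_zero]
    refine eq_zero_of_inner_eigenspace hD hE fun r y hy => ?_
    rw [inner_sub_right, hT.inner hy, (isFn_absInv hD hE).inner hy]
    by_cases hr : |r| ≤ s
    · rcases eq_or_ne r 0 with rfl | hr0
      · simp [f]
      · have hmem : y ∈ spectralSubspace (absOp D) s := by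
          have : eigenspace (absOp D) |r| ≤ spectralSubspace (absOp D) s :=
            le_iSup₂_of_le |r| ⟨abs_pos.mpr hr0, hr⟩ le_rfl
          exact this (eigenspace_le_eigenspace_absOp hD r hy)
        rw [hx y hmem, mul_zero, mul_zero, sub_zero]
    · simp only [f, if_neg hr, sub_self]
  rw [hTx]
  exact ContinuousLinearMap.le_of_opNorm_le _ (norm_bddFnCalc_le hD (by positivity) hf) _

lemma inv_le_singularValue (hD : IsSelfAdjoint D) (hE : IsEssentiallyDiscrete D) {k : ℕ} {s : ℝ}
    (hs : 0 < s)
    (h : ((k + 1 : ℕ) : Cardinal) ≤ Module.rank ℂ (spectralSubspace (absOp D) s)) :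
    s⁻¹ ≤ singularValue k (absInv D) := by
  refine le_singularValue fun E hfin hk => ?_
  obtain ⟨x, hxV, hxE, hx0⟩ := exists_mem_orthogonal_ne_zero hk h
  have hxp : 0 < ‖x‖ := norm_pos_iff.mpr hx0
  have h1 := norm_le_mul_absInv hD hE hs hxV
  have h2 : ‖absInv D x‖ ≤ _ := norm_apply_le_of_mem hxE
  rw [inv_le_iff_one_le_mul₀' hs]
  have h3 : ‖x‖ * 1 ≤ ‖x‖ * (s * ‖absInv D ∘L Eᗮ.subtypeL‖) := by
    calc ‖x‖ * 1 ≤ s * ‖absInv D x‖ := by rwa [mul_one]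
      _ ≤ s * (‖absInv D ∘L Eᗮ.subtypeL‖ * ‖x‖) := by gcongr
      _ = _ := by ring
  exact le_of_mul_le_mul_left h3 hxp

/-- The spectral subspace has dimension at most `k` and serves as the test space itself. -/
lemma singularValue_le_inv (hD : IsSelfAdjoint D) (hE : IsEssentiallyDiscrete D) {k : ℕ} {s : ℝ}
    (hs : 0 < s)
    (h : ¬ ((k + 1 : ℕ) : Cardinal) ≤ Module.rank ℂ (spectralSubspace (absOp D) s)) :
    singularValue k (absInv D) ≤ s⁻¹ := by
  have h1 : Module.rank ℂ (spectralSubspace (absOp D) s) ≤ (k : Cardinal) := by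
    rw [not_le, Nat.cast_succ] at h
    exact Order.lt_succ_iff.mp (by simpa using h)
  have : FiniteDimensional ℂ (spectralSubspace (absOp D) s) :=
    Module.rank_lt_aleph0_iff.mp (h1.trans_lt (Cardinal.natCast_lt_aleph0))
  exact singularValue_le _ (Module.finrank_le_of_rank_le h1) (by positivity) fun x hx =>
    norm_absInv_le_of_mem_orthogonal hD hE hs hx

/-- The singular values of `|D|⁻¹` are the inverses of the eigenvalues of `|D|`. -/
lemma ofReal_singularValue_absInv (hD : IsSelfAdjoint D) (hE : IsEssentiallyDiscrete D) (k : ℕ) :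
    ENNReal.ofReal (singularValue k (absInv D)) = (eigenvalueSeq (absOp D) (k + 1))⁻¹ := by
  refine le_antisymm (ENNReal.le_inv_iff_le_inv.mpr ?_) (ENNReal.inv_le_iff_inv_le.mpr ?_)
  -- A number `q` strictly between the two sides avoids asking whether the infimum defining the
  -- eigenvalue is attained, and covers an infinite eigenvalue as well.
  · by_contra! hlt
    obtain ⟨q, hq1, hq2⟩ := ENNReal.lt_iff_exists_nnreal_btwn.mp hlt
    have hq0 : 0 < (q : ℝ) := by exact_mod_cast zero_le.trans_lt hq1
    rw [← ENNReal.ofReal_coe_nnreal] at hq1 hq2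
    have hnot : ¬ ((k + 1 : ℕ) : Cardinal) ≤ Module.rank ℂ (spectralSubspace (absOp D) q) :=
      fun h => (sInf_le ⟨q, hq0, rfl, h⟩ : eigenvalueSeq (absOp D) (k + 1) ≤ _).not_gt hq2
    have h1 := ENNReal.ofReal_le_ofReal (singularValue_le_inv hD hE hq0 hnot)
    rw [ENNReal.ofReal_inv_of_pos hq0] at h1
    exact (ENNReal.le_inv_iff_le_inv.mp h1).not_gt hq1
  · refine le_sInf ?_
    rintro _ ⟨s, hs, rfl, h⟩
    rw [ENNReal.inv_le_iff_inv_le, ← ENNReal.ofReal_inv_of_pos hs]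
    exact ENNReal.ofReal_le_ofReal (inv_le_singularValue hD hE hs h)

/-! ### The ideal generated by the line element -/

lemma exists_absInv_eq_mul (hD : IsSelfAdjoint D) (hE : IsEssentiallyDiscrete D) :
    ∃ S : H →L[ℂ] H, ‖S‖ ≤ 1 ∧ absInv D = S * lineElement D := by
  have h := abs_mul_abs_inv_le
  refine ⟨bddFnCalc D fun t => t * |t|⁻¹, norm_bddFnCalc_le hD zero_le_one fun t _ => h t, ?_⟩
  refine (isFn_absInv hD hE).eq hD hE
    ((isFn_bddFnCalc hD fun t _ => h t).mul (isFn_lineElement hD hE)) fun t => ?_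
  rcases eq_or_ne t 0 with rfl | ht
  · simp
  · field_simp

lemma singularValue_absInv_le (hD : IsSelfAdjoint D) (hE : IsEssentiallyDiscrete D) (k : ℕ) :
    singularValue k (absInv D) ≤ singularValue k (lineElement D) := by
  obtain ⟨S, hS, h⟩ := exists_absInv_eq_mul hD hE
  rw [h]
  exact (singularValue_mul_le k S _).trans
    (mul_le_of_le_one_left (singularValue_nonneg k _) hS)

lemma mem_span_of_eq (hD : IsSelfAdjoint D) (hE : IsEssentiallyDiscrete D) {T α β ds : H →L[ℂ] H}
    (hT : T = α * absInv D + absInv D * β) (hds : ds = lineElement D ∨ ds = absInv D) :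
    T ∈ TwoSidedIdeal.span {ds} := by
  have h : absInv D ∈ TwoSidedIdeal.span {ds} := by
    rcases hds with rfl | rfl
    · obtain ⟨S, -, h⟩ := exists_absInv_eq_mul hD hE
      rw [h]
      exact TwoSidedIdeal.mul_mem_left _ _ _ (TwoSidedIdeal.subset_span rfl)
    · exact TwoSidedIdeal.subset_span rfl
  rw [hT]
  exact add_mem (TwoSidedIdeal.mul_mem_left _ _ _ h) (TwoSidedIdeal.mul_mem_right _ _ _ h)

end QuantumDifferential

end

open scoped ENNReal InnerProductSpace

noncomputable section

namespace QuantumDifferential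

variable {H : Type*} [NormedAddCommGroup H] [InnerProductSpace ℂ H]
  {D : H →ₗ.[ℂ] H} {a : H →L[ℂ] H}

/-! ### Representations of the quantum differentials -/

lemma abs_mul_phaseSymbol₀ (t : ℝ) : |t| * phaseSymbol₀ t = t := by
  unfold phaseSymbol₀
  split_ifs with h
  · simp [h]
  · have : |t| ≠ 0 := abs_ne_zero.mpr h
    field_simp
    ring

lemma qdiff_eq_of_commutator_eq {F T α β : H →L[ℂ] H} (h : F * a - a * F = α * T + T * β) :
    qdiff F a = Complex.I • α * T + T * (Complex.I • β) := by
  rw [qdiff, h, smul_add, smul_mul_assoc, mul_smul_comm]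

lemma norm_I_smul (T : H →L[ℂ] H) : ‖Complex.I • T‖ = ‖T‖ := by
  rw [norm_smul, Complex.norm_I, one_mul]

variable [CompleteSpace H]

lemma norm_kerProj_mul_mul_le {d G : H →L[ℂ] H} (hG : ‖G‖ ≤ 2) :
    ‖Complex.I • -(kerProj D * d * G)‖ ≤ 2 * ‖d‖ := by
  rw [norm_I_smul, norm_neg]
  have := norm_mul_le_of_le (norm_mul_le_of_le (norm_kerProj_le D) (le_refl ‖d‖) zero_le_one) hG
    (by positivity)
  linarith

lemma norm_mul_mul_kerProj_le {d G : H →L[ℂ] H} (hG : ‖G‖ ≤ 2) :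
    ‖Complex.I • -(G * d * kerProj D)‖ ≤ 2 * ‖d‖ := by
  rw [norm_I_smul, norm_neg]
  have := norm_mul_le_of_le (norm_mul_le_of_le hG (le_refl ‖d‖) zero_le_two) (norm_kerProj_le D)
    (by positivity)
  linarith

lemma norm_one_sub_kerProj_mul_le (hD : IsSelfAdjoint D) (hE : IsEssentiallyDiscrete D)
    {F b c : H →L[ℂ] H} (hF : ‖F‖ ≤ 1) : ‖(1 - kerProj D) * (c - b * F)‖ ≤ ‖c‖ + ‖b‖ := by
  have h1 := norm_mul_le_of_le (norm_one_sub_kerProj_le hD hE) (le_refl ‖c - b * F‖) zero_le_one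
  have h2 := norm_mul_le_of_le (le_refl ‖b‖) hF (norm_nonneg b)
  linarith [norm_sub_le c (b * F)]

lemma norm_mul_one_sub_kerProj_le (hD : IsSelfAdjoint D) (hE : IsEssentiallyDiscrete D)
    {F b c : H →L[ℂ] H} (hF : ‖F‖ ≤ 1) : ‖(c - F * b) * (1 - kerProj D)‖ ≤ ‖c‖ + ‖b‖ := by
  have h1 := norm_mul_le_of_le (le_refl ‖c - F * b‖) (norm_one_sub_kerProj_le hD hE)
    (norm_nonneg _)
  have h2 := norm_mul_le_of_le hF (le_refl ‖b‖) zero_le_one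
  linarith [norm_sub_le c (F * b)]

lemma eq_kerProj_mul (hD : IsSelfAdjoint D) (hE : IsEssentiallyDiscrete D) (d G : H →L[ℂ] H) :
    Complex.I • -(kerProj D * d * G) = kerProj D * (Complex.I • -(kerProj D * d * G)) := by
  rw [mul_smul_comm, mul_neg, ← mul_assoc, ← mul_assoc, kerProj_mul_self hD hE]

lemma eq_mul_kerProj (hD : IsSelfAdjoint D) (hE : IsEssentiallyDiscrete D) (d G : H →L[ℂ] H) :
    Complex.I • -(G * d * kerProj D) = Complex.I • -(G * d * kerProj D) * kerProj D := by
  rw [smul_mul_assoc, neg_mul, mul_assoc _ (kerProj D) (kerProj D), kerProj_mul_self hD hE]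

lemma le_abs_of_isLeast (hD : IsSelfAdjoint D) {l : ℝ}
    (hl : IsLeast {t : ℝ | 0 < t ∧ eigenspace (absOp D) t ≠ ⊥} l) (t : ℝ)
    (ht : eigenspace D t ≠ ⊥) (ht0 : t ≠ 0) : l ≤ |t| :=
  hl.2 ⟨abs_pos.mpr ht0, fun h => ht (le_bot_iff.mp (h ▸ eigenspace_le_eigenspace_absOp hD t))⟩

end QuantumDifferential

end

open QuantumDifferential in
theorem mainTheorem2 {H : Type*} [NormedAddCommGroup H] [InnerProductSpace ℂ H] [CompleteSpace H]
    (A : NonUnitalStarSubalgebra ℂ (H →L[ℂ] H)) (D : H →ₗ.[ℂ] H)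
    (hD : IsEssDiscreteSpectralTriple A D)
    (a : H →L[ℂ] H) (ha : a ∈ A) (habs : HasBoundedCommutator (absOp D) a) :
    -- representations of `i[F₀, a]`
    (∃ α₀ β₀ : H →L[ℂ] H,
      qdiff (phase₀ D) a = α₀ * absInv D + absInv D * β₀ ∧
      ‖α₀‖ ≤ 2 * ‖commutator D a‖ ∧
      ‖β₀‖ ≤ ‖commutator D a‖ + ‖commutator (absOp D) a‖ ∧
      α₀ = kerProj D * α₀) ∧
    (∃ α₀ β₀ : H →L[ℂ] H,
      qdiff (phase₀ D) a = α₀ * absInv D + absInv D * β₀ ∧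
      ‖α₀‖ ≤ ‖commutator D a‖ + ‖commutator (absOp D) a‖ ∧
      ‖β₀‖ ≤ 2 * ‖commutator D a‖ ∧
      β₀ = β₀ * kerProj D) ∧
    -- representations of `i[F, a]`
    (∃ α₁ β₁ : H →L[ℂ] H,
      qdiff (phase D) a = α₁ * absInv D + absInv D * β₁ ∧
      ‖α₁‖ ≤ 2 * ‖commutator D a‖ ∧
      (∀ l : ℝ, IsLeast {t : ℝ | 0 < t ∧ eigenspace (absOp D) t ≠ ⊥} l →
        ‖β₁‖ ≤ 3 * ‖commutator D a‖ + √(1 + (l ^ 2)⁻¹) * ‖commutator (absOp D) a‖) ∧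
      ‖β₁‖ ≤ 3 * ‖commutator D a‖ + ‖commutator (absOp D) a‖ + 2 * ‖a‖ ∧
      α₁ = kerProj D * α₁) ∧
    (∃ α₁ β₁ : H →L[ℂ] H,
      qdiff (phase D) a = α₁ * absInv D + absInv D * β₁ ∧
      (∀ l : ℝ, IsLeast {t : ℝ | 0 < t ∧ eigenspace (absOp D) t ≠ ⊥} l →
        ‖α₁‖ ≤ 3 * ‖commutator D a‖ + √(1 + (l ^ 2)⁻¹) * ‖commutator (absOp D) a‖) ∧
      ‖α₁‖ ≤ 3 * ‖commutator D a‖ + ‖commutator (absOp D) a‖ + 2 * ‖a‖ ∧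
      ‖β₁‖ ≤ 2 * ‖commutator D a‖ ∧
      β₁ = β₁ * kerProj D) ∧
    -- the quantum differentials lie in the ideal generated by the line element
    (∀ ds : H →L[ℂ] H, ds = lineElement D ∨ ds = absInv D →
      qdiff (phase₀ D) a ∈ TwoSidedIdeal.span {ds} ∧ qdiff (phase D) a ∈ TwoSidedIdeal.span {ds}) ∧
    -- the singular values
    (∀ k : ℕ, ENNReal.ofReal (singularValue k (absInv D)) = (eigenvalueSeq (absOp D) (k + 1))⁻¹) ∧
    (∀ F : H →L[ℂ] H, F = phase₀ D ∨ F = phase D →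
      ∀ α β : H →L[ℂ] H, qdiff F a = α * absInv D + absInv D * β →
      ∀ k : ℕ, singularValue (2 * k) (qdiff F a) ≤ (‖α‖ + ‖β‖) * singularValue k (absInv D)) ∧
    (∀ F : H →L[ℂ] H, F = phase₀ D ∨ F = phase D →
      ∃ C : ℝ, ∀ k : ℕ,
        singularValue (2 * k) (qdiff F a) ≤ C * singularValue k (lineElement D)) := by
  have hsa := hD.isSelfAdjoint
  have hE := hD.isEssentiallyDiscrete
  have hd := hasKernel_commutator hsa (hD.hasBoundedCommutator a ha)
  have hb := hasKernel_commutator_absOp hsa habs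
  set d := commutator D a
  set b := commutator (absOp D) a
  have hF₀ := isFn_phase₀ hsa
  have hF₀1 : ‖phase₀ D‖ ≤ 1 := hF₀.norm_le hsa hE zero_le_one fun t _ => abs_phaseSymbol₀_le t
  have hF := isFn_phase hsa
  have hF1 : ‖phase D‖ ≤ 1 := hF.norm_le hsa hE zero_le_one fun t _ => abs_phaseSymbol_le t
  have hg₀ := abs_defectSymbol_le abs_phaseSymbol₀_le
  have hg := abs_defectSymbol_le abs_phaseSymbol_le
  have hG₀ := isFn_bddFnCalc hsa fun t _ => hg₀ t
  have hG₀2 := norm_bddFnCalc_le hsa zero_le_two fun t _ => hg₀ t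
  have hG := isFn_bddFnCalc hsa fun t _ => hg t
  have hG2 := norm_bddFnCalc_le hsa zero_le_two fun t _ => hg t
  obtain ⟨c, hc, hcn⟩ := exists_norm_abs_phase_commutator_le hsa hd
  -- Since `|D| F₀ = D`, the commutator `[D, a]` itself plays the role of `c`.
  have hd₀ : HasKernel D a d fun s t => |s| * phaseSymbol₀ s - |t| * phaseSymbol₀ t := by
    simpa only [abs_mul_phaseSymbol₀] using hd
  have h1 := qdiff_eq_of_commutator_eq
    (commutator_eq_left hsa hE phaseSymbol₀_zero hF₀ hG₀ hd hb hd₀)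
  have h2 := qdiff_eq_of_commutator_eq
    (commutator_eq_right hsa hE phaseSymbol₀_zero hF₀ hG₀ hd hb hd₀)
  have h3 := qdiff_eq_of_commutator_eq
    (commutator_eq_left hsa hE phaseSymbol_zero hF hG hd hb hc)
  have h4 := qdiff_eq_of_commutator_eq
    (commutator_eq_right hsa hE phaseSymbol_zero hF hG hd hb hc)
  have hnd := norm_nonneg d
  refine ⟨⟨_, _, h1, norm_kerProj_mul_mul_le hG₀2, ?_, eq_kerProj_mul hsa hE _ _⟩,
    ⟨_, _, h2, ?_, norm_mul_mul_kerProj_le hG₀2, eq_mul_kerProj hsa hE _ _⟩,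
    ⟨_, _, h3, norm_kerProj_mul_mul_le hG2, fun l hl => ?_, ?_, eq_kerProj_mul hsa hE _ _⟩,
    ⟨_, _, h4, fun l hl => ?_, ?_, norm_mul_mul_kerProj_le hG2, eq_mul_kerProj hsa hE _ _⟩,
    fun ds hds => ⟨mem_span_of_eq hsa hE h1 hds, mem_span_of_eq hsa hE h3 hds⟩,
    ofReal_singularValue_absInv hsa hE, ?_, ?_⟩
  · rw [norm_I_smul]
    exact norm_one_sub_kerProj_mul_le hsa hE hF₀1
  · rw [norm_I_smul]
    exact norm_mul_one_sub_kerProj_le hsa hE hF₀1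
  · rw [norm_I_smul]
    exact norm_left_le hsa hE hF hF1 hG hG2 hd hb hc hl.1.1 (le_abs_of_isLeast hsa hl)
  · rw [norm_I_smul]
    -- The argument gives `‖d‖` in place of `3‖d‖` here; `hnd` supplies the slack.
    linarith [norm_one_sub_kerProj_mul_le hsa hE (b := b) (c := c) hF1]
  · rw [norm_I_smul]
    exact norm_right_le hsa hE hF hF1 hG hG2 hd hb hc hl.1.1 (le_abs_of_isLeast hsa hl)
  · rw [norm_I_smul]
    linarith [norm_mul_one_sub_kerProj_le hsa hE (b := b) (c := c) hF1]
  · intro F _ α β h k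
    rw [h]
    exact singularValue_mul_add_mul_le k α β _
  · have key : ∀ T α β : H →L[ℂ] H, T = α * absInv D + absInv D * β →
        ∃ C : ℝ, ∀ k : ℕ, singularValue (2 * k) T ≤ C * singularValue k (lineElement D) := by
      rintro _ α β rfl
      refine ⟨‖α‖ + ‖β‖, fun k => (singularValue_mul_add_mul_le k α β _).trans ?_⟩
      exact mul_le_mul_of_nonneg_left (singularValue_absInv_le hsa hE k) (by positivity)
    rintro F (rfl | rfl)
    · exact key _ _ _ h1
    · exact key _ _ _ h3
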